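/- Let $\Bbbk$ be an algebraically closed field of characteristic $0$ and let $X$ be a nonempty finite set. Algebras are associative and unital over $\Bbbk$, and $h\mapsto h_1\otimes h_2$ denotes comultiplication. **The weak Hopf algebra $H$.** Let $\mathcal G$ be a groupoid with object set $X$; its morphisms are $g\colon s(g)\to t(g)$, with identities $e_x$, and $\Bbbk\mathcal G$ is its groupoid algebra. Let $\mathfrak G=\bigoplus_{x\in X}\mathfrak g_x$ be an $X$-Lie algebroid, i.e. a direct sum of Lie algebras $\mathfrak g_x$ over $\Bbbk$. Let $\mathcal G$ act on $\mathfrak G$, i.e. let a functor with $x\mapsto\mathfrak g_x$ be given that sends each morphism $g\colon x\to y$ to a Lie algebra isomorphism $\mathfrak g_x\to\mathfrak g_y$, $p\mapsto g\cdot p$. The induced isomorphisms $U(\mathfrak g_x)\to U(\mathfrak g_y)$, extended by $0$ to the other summands, make $U_X(\mathfrak G)=\bigoplus_{x}U(\mathfrak g_x)$ a $\Bbbk\mathcal G$-module. Let $H=U_X(\mathfrak G)\#\Bbbk\mathcal G=\bigoplus_{g\in\mathcal G_1}U(\mathfrak g_{t(g)})\# g$ be the smash product: the product $(a\#g)(b\#h)$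 is $a(g\cdot b)\#gh$ if $s(g)=t(h)$ and $0$ otherwise, $1_H=\sum_x f_x$ with $f_x=1_{U(\mathfrak g_x)}\#e_x$, $\Delta(a\#g)=(a_1\#g)\otimes(a_2\#g)$, $\varepsilon(a\#g)=\varepsilon(a)$, and $S(a\#g)=g^{-1}\cdot S(a)\#g^{-1}$. It is a cocommutative weak Hopf algebra. **Module algebras and homomorphisms.** An $H$-module algebra structure on an algebra $A$ is an $H$-module structure with $h\cdot(ab)=(h_1\cdot a)(h_2\cdot b)$ and $h\cdot 1_A=\varepsilon_t(h)\cdot 1_A$, where $\varepsilon_t(h)=\varepsilon(1_1h)1_2$. An $X$-weak Hopf algebra is a weak Hopf algebra with a complete family of nonzero orthogonal grouplike idempotents indexed by $X$ (for $H$: the family $(f_x)_{x\in X}$). An $X$-weak Hopf algebra homomorphism is a unital algebra and coalgebra map that commutes with the antipodes and preserves the idempotents indexed by $X$. **Decomposable algebras.** An $X$-decomposition of an algebra $A$ is a decomposition $A=\bigoplus_{x\in X}A_x$ as a direct sum of unital algebras, some of which may be $0$. Given one, let $\mathrm{Aut}_{X\text{-}\mathsf{Alg}}(A)$ be the groupoid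 with object set $X$ (the object $x$ standing for $A_x$) whose morphisms $x\to y$ are the isomorphisms of unital algebras $A_x\to A_y$, and let $\mathrm{Der}_X(A)$ be the $X$-Lie algebroid $\bigoplus_{x}\mathrm{Der}(A_x)$, on which $\mathrm{Aut}_{X\text{-}\mathsf{Alg}}(A)$ acts by conjugation. Form $U_X(\mathrm{Der}_X(A))\#\Bbbk(\mathrm{Aut}_{X\text{-}\mathsf{Alg}}(A))$ as above. **Theorem.** For an algebra $A$, the following are equivalent. (a) $A$ is an $H$-module algebra, i.e. there is an $H$-module algebra structure on $A$. (b) There are an $X$-decomposition $A=\bigoplus_x A_x$, a functor $\pi\colon\mathcal G\to\mathrm{Aut}_{X\text{-}\mathsf{Alg}}(A)$ that is the identity on $X$, and a family $\tau=(\tau_x)_{x\in X}$ of Lie algebra homomorphisms $\tau_x\colon\mathfrak g_x\to\mathrm{Der}(A_x)$, such that the induced maps $\widetilde\pi\colon\Bbbk\mathcal G\to\Bbbk(\mathrm{Aut}_{X\text{-}\mathsf{Alg}}(A))$ and $\widetilde\tau\colon U_X(\mathfrak G)\to U_X(\mathrm{Der}_X(A))$ satisfy $\widetilde\tau(r\cdot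 m)=\widetilde\pi(r)\cdot\widetilde\tau(m)$ for all $r\in\Bbbk\mathcal G$ and $m\in U_X(\mathfrak G)$. (c) There are an $X$-decomposition $A=\bigoplus_x A_x$ and an $X$-weak Hopf algebra homomorphism $\phi\colon H\to U_X(\mathrm{Der}_X(A))\#\Bbbk(\mathrm{Aut}_{X\text{-}\mathsf{Alg}}(A))$. The decompositions correspond through $A_x=(f_x\cdot1_A)A$, in the following sense. For every $H$-module algebra structure on $A$ there is an $X$-decomposition of $A$ with $A_x=(f_x\cdot 1_A)A$ for all $x\in X$. Moreover, for each fixed $X$-decomposition $A=\bigoplus_xA_x$, the following are equivalent: there is an $H$-module algebra structure on $A$ with $A_x=(f_x\cdot1_A)A$ for all $x\in X$; there are $\pi,\tau$ as in (b) for this decomposition; there is $\phi$ as in (c) for this decomposition. -/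

import Mathlib

open CategoryTheory
open scoped TensorProduct

universe u v v' w

noncomputable section

/-! ## Weak Hopf algebras and their module algebras -/

section WeakHopf

/-- A weak bialgebra over `k`: a `k`-algebra and a `k`-coalgebra such that `Δ` is multiplicative,
`ε(abc) = ε(ab₁)ε(b₂c) = ε(ab₂)ε(b₁c)`, and
`Δ²(1) = (Δ(1) ⊗ 1)(1 ⊗ Δ(1)) = (1 ⊗ Δ(1))(Δ(1) ⊗ 1)`. -/
class WeakBialgebra (k : Type*) [Field k] (H : Type*) [Ring H] [Algebra k H] extends Coalgebra k H where
  comul_mul' (a b : H) : comul (a * b) = comul a * comul b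
  counit_mul_mul (a b c : H) : counit (a * b * c) =
    LinearMap.mul' k k (TensorProduct.map (counit ∘ₗ LinearMap.mulLeft k a)
      (counit ∘ₗ LinearMap.mulRight k c) (comul b))
  counit_mul_mul_swap (a b c : H) : counit (a * b * c) =
    LinearMap.mul' k k (TensorProduct.map (counit ∘ₗ LinearMap.mulRight k c)
      (counit ∘ₗ LinearMap.mulLeft k a) (comul b))
  comul_comul_one : TensorProduct.assoc k H H H (comul.rTensor H (comul 1)) =
    TensorProduct.assoc k H H H (comul 1 ⊗ₜ[k] (1 : H)) * ((1 : H) ⊗ₜ[k] comul 1)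
  comul_comul_one_swap : TensorProduct.assoc k H H H (comul.rTensor H (comul 1)) =
    ((1 : H) ⊗ₜ[k] comul 1) * TensorProduct.assoc k H H H (comul 1 ⊗ₜ[k] (1 : H))

open Coalgebra

/-- The source counital map `ε_s(h) = 1₁ ε(h 1₂)`. -/
def sourceCounital (k : Type*) [Field k] {H : Type*} [Ring H] [Algebra k H] [WeakBialgebra k H] (h : H) : H :=
  TensorProduct.rid k H ((counit ∘ₗ LinearMap.mulLeft k h).lTensor H (comul (R := k) (1 : H)))

/-- The target counital map `ε_t(h) = ε(1₁ h) 1₂`. -/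
def targetCounital (k : Type*) [Field k] {H : Type*} [Ring H] [Algebra k H] [WeakBialgebra k H] (h : H) : H :=
  TensorProduct.lid k H ((counit ∘ₗ LinearMap.mulRight k h).rTensor H (comul (R := k) (1 : H)))

/-- A weak Hopf algebra over `k`: a weak bialgebra with an antipode `S` such that
`S(h₁)h₂ = ε_s(h)`, `h₁S(h₂) = ε_t(h)`, `S(h₁)h₂S(h₃) = S(h)`. -/
class WeakHopfAlgebra (k : Type*) [Field k] (H : Type*) [Ring H] [Algebra k H] extends WeakBialgebra k H where
  weakAntipode (k) : H →ₗ[k] H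
  antipode_mul (h : H) :
    LinearMap.mul' k H (weakAntipode.rTensor H (comul h)) = sourceCounital k h
  mul_antipode (h : H) :
    LinearMap.mul' k H (weakAntipode.lTensor H (comul h)) = targetCounital k h
  antipode_mul_antipode (h : H) :
    LinearMap.mul' k H (TensorProduct.map (LinearMap.mul' k H ∘ₗ weakAntipode.rTensor H)
      weakAntipode (comul.rTensor H (comul h))) = weakAntipode h

variable (k : Type*) [Field k]

/-- An `H`-module algebra structure on the algebra `A`, for a weak Hopf algebra `H`:
an `H`-module structure (given by an algebra map `ρ : H → End(A)`, `h · a = ρ h a`) such that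
`h · (ab) = (h₁ · a)(h₂ · b)` and `h · 1 = ε_t(h) · 1`. -/
structure ModuleAlgebra (H : Type*) [Ring H] [Algebra k H] [WeakHopfAlgebra k H]
    (A : Type*) [Ring A] [Algebra k A] where
  ρ : H →ₐ[k] Module.End k A
  act_mul (h : H) (a b : A) : ρ h (a * b) =
    LinearMap.mul' k A (TensorProduct.map (ρ.toLinearMap.flip a) (ρ.toLinearMap.flip b) (comul h))
  act_one (h : H) : ρ h 1 = ρ (targetCounital k h) 1

/-- The family `e` makes the weak Hopf algebra `H` an `X`-weak Hopf algebra: it is a complete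
family of nonzero orthogonal idempotents that are grouplike. -/
structure IsXBase {X : Type*} [Fintype X] {H : Type*} [Ring H] [Algebra k H]
    [WeakHopfAlgebra k H] (e : X → H) : Prop where
  complete : CompleteOrthogonalIdempotents e
  ne_zero (x : X) : e x ≠ 0
  grouplike (x : X) : IsGroupLikeElem k (e x)

/-- `X`-weak Hopf algebra homomorphisms: unital algebra maps that are coalgebra maps, commute with
the antipodes and preserve the given idempotents. -/
structure XWeakHopfHom {X : Type*} {H K : Type*} [Ring H] [Algebra k H] [WeakHopfAlgebra k H]
    [Ring K] [Algebra k K] [WeakHopfAlgebra k K] (e : X → H) (e' : X → K)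
    extends H →ₐc[k] K where
  map_antipode (h : H) : toFun (WeakHopfAlgebra.weakAntipode k h) =
    WeakHopfAlgebra.weakAntipode k (toFun h)
  map_base (x : X) : toFun (e x) = e' x

end WeakHopf


/-! ## Lie-theoretic preliminaries -/

section Lie

attribute [local instance] LieRing.ofAssociativeRing

variable (k : Type*) [Field k]

/-- The Lie algebra `Der(A)` of `k`-linear derivations of a (not necessarily commutative) algebra
`A`, as a Lie subalgebra of `gl(A)` with the commutator bracket. -/
def derLie (A : Type*) [Ring A] [Algebra k A] : LieSubalgebra k (Module.End k A) where
  carrier := {D | ∀ a b, D (a * b) = a * D b + D a * b}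
  add_mem' {D E} hD hE a b := by
    simp only [Set.mem_ofPred_eq] at hD hE
    simp only [LinearMap.add_apply, hD, hE, mul_add, add_mul]; abel
  zero_mem' a b := by simp
  smul_mem' c D hD a b := by
    simp only [Set.mem_ofPred_eq] at hD
    simp only [LinearMap.smul_apply, hD, smul_add, mul_smul_comm, smul_mul_assoc]
  lie_mem' {D E} hD hE a b := by
    change ∀ a b, _ at hD
    change ∀ a b, _ at hE
    simp only [LieRing.of_associative_ring_bracket, LinearMap.sub_apply, Module.End.mul_apply,
      hD, hE, map_add, mul_sub, sub_mul]
    abel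

variable {k}

/-- Conjugation `D ↦ α D α⁻¹` by an algebra isomorphism `α : A → B`, as a Lie algebra map
`Der(A) → Der(B)`. -/
def derConj {A B : Type*} [Ring A] [Algebra k A] [Ring B] [Algebra k B] (α : A ≃ₐ[k] B) :
    derLie k A →ₗ⁅k⁆ derLie k B where
  toFun D := ⟨α.toLinearMap ∘ₗ D.1 ∘ₗ α.symm.toLinearMap, fun a b => by
    have hD : ∀ a b, D.1 (a * b) = a * D.1 b + D.1 a * b := D.2
    simp [hD]⟩
  map_add' D E := by ext; simp
  map_smul' c D := by ext; simp
  map_lie' {D E} := by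
    ext; simp [LieRing.of_associative_ring_bracket]

open UniversalEnvelopingAlgebra

/-- The algebra map `U(𝔤) → U(𝔥)` induced by a Lie algebra map `𝔤 → 𝔥`. -/
def univEnvMap {L M : Type*} [LieRing L] [LieAlgebra k L] [LieRing M] [LieAlgebra k M]
    (f : L →ₗ⁅k⁆ M) : UniversalEnvelopingAlgebra k L →ₐ[k] UniversalEnvelopingAlgebra k M :=
  lift k ((ι k).comp f)

variable (k)

/-- `Δ(p) = p ⊗ 1 + 1 ⊗ p` on `U(𝔤)`. -/
def univEnvComul (L : Type*) [LieRing L] [LieAlgebra k L] :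
    UniversalEnvelopingAlgebra k L →ₐ[k]
      UniversalEnvelopingAlgebra k L ⊗[k] UniversalEnvelopingAlgebra k L :=
  lift k
    { toFun := fun p => ι k p ⊗ₜ 1 + 1 ⊗ₜ ι k p
      map_add' := fun p q => by simp only [map_add, TensorProduct.add_tmul, TensorProduct.tmul_add]; abel
      map_smul' := fun c p => by simp [TensorProduct.smul_tmul']
      map_lie' := fun {p q} => by
        simp only [LieHom.map_lie, LieRing.of_associative_ring_bracket, TensorProduct.sub_tmul, TensorProduct.tmul_sub,
          mul_add, add_mul, Algebra.TensorProduct.tmul_mul_tmul, one_mul, mul_one]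
        abel }

/-- `ε(p) = 0` on `U(𝔤)`. -/
def univEnvCounit (L : Type*) [LieRing L] [LieAlgebra k L] :
    UniversalEnvelopingAlgebra k L →ₐ[k] k :=
  lift k 0

/-- `S(p) = -p` on `U(𝔤)`, as an algebra map to the opposite algebra. -/
def univEnvAntipode (L : Type*) [LieRing L] [LieAlgebra k L] :
    UniversalEnvelopingAlgebra k L →ₐ[k] (UniversalEnvelopingAlgebra k L)ᵐᵒᵖ :=
  lift k
    { toFun := fun p => MulOpposite.op (-ι k p)
      map_add' := fun p q => by simp [add_comm]
      map_smul' := fun c p => by simp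
      map_lie' := fun {p q} => by
        simp only [LieHom.map_lie, LieRing.of_associative_ring_bracket, ← MulOpposite.op_mul,
          ← MulOpposite.op_sub]
        congr 1; noncomm_ring }

theorem univEnv_induction {L : Type*} [LieRing L] [LieAlgebra k L]
    (S : Subalgebra k (UniversalEnvelopingAlgebra k L)) (h : ∀ p, ι k p ∈ S)
    (a : UniversalEnvelopingAlgebra k L) : a ∈ S := by
  let f : L →ₗ⁅k⁆ S :=
    { toFun := fun p => ⟨ι k p, h p⟩
      map_add' := fun p q => by ext; simp only [map_add]; rfl
      map_smul' := fun c p => by ext; simp only [map_smul]; rfl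
      map_lie' := fun {p q} => by
        ext; simp only [LieHom.map_lie, LieRing.of_associative_ring_bracket]; rfl }
  have : S.val.comp (lift k f) = AlgHom.id k _ := by
    ext p
    simp only [LieHom.comp_apply, AlgHom.coe_toLieHom, AlgHom.comp_apply, AlgHom.id_apply]
    rw [lift_ι_apply]; rfl
  rw [← AlgHom.id_apply (R := k) a, ← this]
  exact (lift k f a).2

theorem univEnv_algHom_ext {L B : Type*} [LieRing L] [LieAlgebra k L] [Ring B] [Algebra k B]
    {f g : UniversalEnvelopingAlgebra k L →ₐ[k] B} (h : ∀ p, f (ι k p) = g (ι k p)) : f = g :=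
  AlgHom.ext (univEnv_induction k (AlgHom.equalizer f g) h)

@[simp] theorem univEnvComul_ι {L : Type*} [LieRing L] [LieAlgebra k L] (p : L) :
    univEnvComul k L (ι k p) = ι k p ⊗ₜ 1 + 1 ⊗ₜ ι k p := lift_ι_apply _ _ _

@[simp] theorem univEnvCounit_ι {L : Type*} [LieRing L] [LieAlgebra k L] (p : L) :
    univEnvCounit k L (ι k p) = 0 := lift_ι_apply _ _ _

@[simp] theorem univEnvAntipode_ι {L : Type*} [LieRing L] [LieAlgebra k L] (p : L) :
    univEnvAntipode k L (ι k p) = MulOpposite.op (-ι k p) := lift_ι_apply _ _ _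

instance univEnvBialgebra (L : Type*) [LieRing L] [LieAlgebra k L] :
    Bialgebra k (UniversalEnvelopingAlgebra k L) :=
  Bialgebra.ofAlgHom (univEnvComul k L) (univEnvCounit k L)
    (by
      ext p
      simp only [LieHom.comp_apply, AlgHom.coe_toLieHom, AlgHom.comp_apply, univEnvComul_ι,
        map_add, Algebra.TensorProduct.map_tmul, map_one, AlgHom.id_apply,
        TensorProduct.add_tmul, TensorProduct.tmul_add, Algebra.TensorProduct.one_def]
      abel)
    (by
      refine univEnv_algHom_ext k fun p => ?_
      simp only [AlgHom.comp_apply, univEnvComul_ι,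
        map_add, Algebra.TensorProduct.map_tmul, map_one, AlgHom.id_apply, univEnvCounit_ι,
        TensorProduct.zero_tmul, zero_add]
      rfl)
    (by
      refine univEnv_algHom_ext k fun p => ?_
      simp only [AlgHom.comp_apply, univEnvComul_ι,
        map_add, Algebra.TensorProduct.map_tmul, map_one, AlgHom.id_apply, univEnvCounit_ι,
        TensorProduct.tmul_zero, add_zero]
      rfl)

theorem antipode_rTensor_mul {H : Type*} [Ring H] [Bialgebra k H] (S : H →ₗ[k] H)
    (hS : ∀ a b, S (a * b) = S b * S a) {a b : H}
    (ha : LinearMap.mul' k H (S.rTensor H (Coalgebra.comul a)) =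
      algebraMap k H (Coalgebra.counit a))
    (hb : LinearMap.mul' k H (S.rTensor H (Coalgebra.comul b)) =
      algebraMap k H (Coalgebra.counit b)) :
    LinearMap.mul' k H (S.rTensor H (Coalgebra.comul (a * b))) =
      algebraMap k H (Coalgebra.counit (a * b)) := by
  have key : ∀ x y : H ⊗[k] H, LinearMap.mul' k H (S.rTensor H x) =
      algebraMap k H (Coalgebra.counit a) →
      LinearMap.mul' k H (S.rTensor H (x * y)) =
        Coalgebra.counit (R := k) a • LinearMap.mul' k H (S.rTensor H y) := by
    intro x y hx
    induction y using TensorProduct.induction_on with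
    | zero => simp
    | add y z hy hz => simp [mul_add, hy, hz]
    | tmul u v =>
      have : LinearMap.mul' k H (S.rTensor H (x * (u ⊗ₜ v))) =
          S u * LinearMap.mul' k H (S.rTensor H x) * v := by
        clear hx
        induction x using TensorProduct.induction_on with
        | zero => simp
        | add y z hy hz => simp [mul_add, add_mul, hy, hz]
        | tmul w z => simp [hS, mul_assoc]
      rw [this, hx, ← Algebra.commutes]
      simp [Algebra.smul_def, mul_assoc]
  rw [Bialgebra.comul_mul, key _ _ ha, hb, Bialgebra.counit_mul, map_mul, Algebra.smul_def]

theorem antipode_lTensor_mul {H : Type*} [Ring H] [Bialgebra k H] (S : H →ₗ[k] H)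
    (hS : ∀ a b, S (a * b) = S b * S a) {a b : H}
    (ha : LinearMap.mul' k H (S.lTensor H (Coalgebra.comul a)) =
      algebraMap k H (Coalgebra.counit a))
    (hb : LinearMap.mul' k H (S.lTensor H (Coalgebra.comul b)) =
      algebraMap k H (Coalgebra.counit b)) :
    LinearMap.mul' k H (S.lTensor H (Coalgebra.comul (a * b))) =
      algebraMap k H (Coalgebra.counit (a * b)) := by
  have key : ∀ x y : H ⊗[k] H, LinearMap.mul' k H (S.lTensor H y) =
      algebraMap k H (Coalgebra.counit b) →
      LinearMap.mul' k H (S.lTensor H (x * y)) =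
        Coalgebra.counit (R := k) b • LinearMap.mul' k H (S.lTensor H x) := by
    intro x y hy
    induction x using TensorProduct.induction_on with
    | zero => simp
    | add y z hy hz => simp [add_mul, hy, hz]
    | tmul u v =>
      have : LinearMap.mul' k H (S.lTensor H ((u ⊗ₜ v) * y)) =
          u * LinearMap.mul' k H (S.lTensor H y) * S v := by
        clear hy
        induction y using TensorProduct.induction_on with
        | zero => simp
        | add y z hy hz => simp [mul_add, add_mul, hy, hz]
        | tmul w z => simp [hS, mul_assoc]
      rw [this, hy, ← Algebra.commutes]
      simp [Algebra.smul_def, mul_assoc]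
  rw [Bialgebra.comul_mul, key _ _ hb, ha, Bialgebra.counit_mul,
    mul_comm (Coalgebra.counit (R := k) a), map_mul, Algebra.smul_def]

/-- The antipode of `U(𝔤)`, as a linear endomorphism. -/
def univEnvS (L : Type*) [LieRing L] [LieAlgebra k L] :
    UniversalEnvelopingAlgebra k L →ₗ[k] UniversalEnvelopingAlgebra k L :=
  (MulOpposite.opLinearEquiv k).symm.toLinearMap ∘ₗ (univEnvAntipode k L).toLinearMap

theorem univEnvS_mul {L : Type*} [LieRing L] [LieAlgebra k L]
    (a b : UniversalEnvelopingAlgebra k L) :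
    univEnvS k L (a * b) = univEnvS k L b * univEnvS k L a := by simp [univEnvS]

theorem univEnvS_one {L : Type*} [LieRing L] [LieAlgebra k L] :
    univEnvS k L 1 = 1 := by simp [univEnvS]

theorem univEnvS_ι {L : Type*} [LieRing L] [LieAlgebra k L] (p : L) :
    univEnvS k L (ι k p) = - ι k p := by
  simp only [univEnvS, LinearMap.comp_apply, AlgHom.toLinearMap_apply, univEnvAntipode_ι]; rfl

/-- The classical Hopf algebra structure on the universal enveloping algebra. -/
instance univEnvHopf (L : Type*) [LieRing L] [LieAlgebra k L] :
    HopfAlgebra k (UniversalEnvelopingAlgebra k L) where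
  antipode := univEnvS k L
  mul_antipode_rTensor_comul := by
    ext a
    let T : Subalgebra k (UniversalEnvelopingAlgebra k L) :=
      { carrier := {a | LinearMap.mul' k _ ((univEnvS k L).rTensor _ (Coalgebra.comul a)) =
          algebraMap k _ (Coalgebra.counit a)}
        mul_mem' := fun ha hb => antipode_rTensor_mul k _ (univEnvS_mul k) ha hb
        add_mem' := fun {a b} ha hb => by
          change LinearMap.mul' k _ _ = _ at ha
          change LinearMap.mul' k _ _ = _ at hb
          change LinearMap.mul' k _ _ = _
          rw [map_add, map_add, map_add, ha, hb, map_add, map_add]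
        algebraMap_mem' := fun c => by
          change LinearMap.mul' k _ _ = _
          simp [Algebra.algebraMap_eq_smul_one, univEnvS_one, Algebra.TensorProduct.one_def] }
    refine univEnv_induction k T (fun p => ?_) a
    change LinearMap.mul' k _ ((univEnvS k L).rTensor _ (univEnvComul k L (ι k p))) =
      algebraMap k _ (univEnvCounit k L (ι k p))
    rw [univEnvComul_ι, univEnvCounit_ι]
    simp only [map_add, LinearMap.rTensor_tmul, LinearMap.mul'_apply, univEnvS_ι, univEnvS_one,
      map_zero]
    simp only [mul_one, one_mul, neg_add_cancel]
  mul_antipode_lTensor_comul := by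
    ext a
    let T : Subalgebra k (UniversalEnvelopingAlgebra k L) :=
      { carrier := {a | LinearMap.mul' k _ ((univEnvS k L).lTensor _ (Coalgebra.comul a)) =
          algebraMap k _ (Coalgebra.counit a)}
        mul_mem' := fun ha hb => antipode_lTensor_mul k _ (univEnvS_mul k) ha hb
        add_mem' := fun {a b} ha hb => by
          change LinearMap.mul' k _ _ = _ at ha
          change LinearMap.mul' k _ _ = _ at hb
          change LinearMap.mul' k _ _ = _
          rw [map_add, map_add, map_add, ha, hb, map_add, map_add]
        algebraMap_mem' := fun c => by
          change LinearMap.mul' k _ _ = _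
          simp [Algebra.algebraMap_eq_smul_one, univEnvS_one, Algebra.TensorProduct.one_def] }
    refine univEnv_induction k T (fun p => ?_) a
    change LinearMap.mul' k _ ((univEnvS k L).lTensor _ (univEnvComul k L (ι k p))) =
      algebraMap k _ (univEnvCounit k L (ι k p))
    rw [univEnvComul_ι, univEnvCounit_ι]
    simp only [map_add, LinearMap.lTensor_tmul, LinearMap.mul'_apply, univEnvS_ι, univEnvS_one,
      map_zero]
    simp only [mul_one, one_mul, add_neg_cancel]

variable {k}

/-- The map `U(𝔤) → U(𝔥)` induced by a Lie algebra map, as a bialgebra map. -/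
def univEnvMapBialg {L M : Type*} [LieRing L] [LieAlgebra k L] [LieRing M] [LieAlgebra k M]
    (f : L →ₗ⁅k⁆ M) : UniversalEnvelopingAlgebra k L →ₐc[k] UniversalEnvelopingAlgebra k M :=
  BialgHom.ofAlgHom (univEnvMap f)
    (by
      change (univEnvCounit k M).comp _ = univEnvCounit k L
      refine univEnv_algHom_ext k fun p => ?_
      simp only [LieHom.comp_apply, AlgHom.comp_apply, univEnvMap, lift_ι_apply, univEnvCounit_ι])
    (by
      change (Algebra.TensorProduct.map _ _).comp (univEnvComul k L) = (univEnvComul k M).comp _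
      refine univEnv_algHom_ext k fun p => ?_
      simp only [LieHom.comp_apply, AlgHom.comp_apply, univEnvMap,
        lift_ι_apply, univEnvComul_ι, map_add, Algebra.TensorProduct.map_tmul, map_one])

theorem univEnvMapBialg_ι {L M : Type*} [LieRing L] [LieAlgebra k L] [LieRing M] [LieAlgebra k M]
    (f : L →ₗ⁅k⁆ M) (p : L) : univEnvMapBialg f (ι k p) = ι k (f p) :=
  lift_ι_apply k ((ι k).comp f) p

theorem univEnv_bialgHom_ext {L M : Type*} [LieRing L] [LieAlgebra k L] [LieRing M]
    [LieAlgebra k M] {f g : UniversalEnvelopingAlgebra k L →ₐc[k] UniversalEnvelopingAlgebra k M}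
    (h : ∀ p, f (ι k p) = g (ι k p)) : f = g :=
  BialgHom.ext (AlgHom.congr_fun (univEnv_algHom_ext k
    (f := AlgHomClass.toAlgHom f) (g := AlgHomClass.toAlgHom g) h))

theorem univEnvMapBialg_id (L : Type*) [LieRing L] [LieAlgebra k L] :
    univEnvMapBialg (LieHom.id : L →ₗ⁅k⁆ L) = BialgHom.id k _ :=
  univEnv_bialgHom_ext fun p => univEnvMapBialg_ι _ p

theorem univEnvMapBialg_comp {L M N : Type*} [LieRing L] [LieAlgebra k L] [LieRing M]
    [LieAlgebra k M] [LieRing N] [LieAlgebra k N] (g : M →ₗ⁅k⁆ N) (f : L →ₗ⁅k⁆ M) :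
    univEnvMapBialg (g.comp f) = (univEnvMapBialg g).comp (univEnvMapBialg f) :=
  univEnv_bialgHom_ext fun p => by
    rw [univEnvMapBialg_ι, BialgHom.comp_apply, univEnvMapBialg_ι, univEnvMapBialg_ι]; rfl

end Lie

/-! ## Groupoid algebras and smash products -/

section Smash

/-- Morphisms of a groupoid `𝒢` with object set `X`, all collected in one type. -/
structure GrpdMor {X : Type*} (𝒢 : Groupoid.{v} X) where
  {src tgt : X}
  hom : 𝒢.Hom src tgt

instance {X : Type*} (𝒢 : Groupoid.{v} X) : DecidableEq (GrpdMor 𝒢) := Classical.decEq _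

/-- An action of a groupoid `𝒢` with object set `X` on a family `(B x)` of Hopf algebras (that is,
on the `X`-decomposable weak Hopf algebra `⨁ x, B x`) by bialgebra maps: a functor with
`x ↦ B x`. Each `map g` is then invertible, with inverse `map g⁻¹`. -/
structure HopfAction (k : Type*) [Field k] {X : Type*} (𝒢 : Groupoid.{v} X) (B : X → Type*)
    [∀ x, Ring (B x)] [∀ x, HopfAlgebra k (B x)] where
  map {x y : X} : 𝒢.Hom x y → (B x →ₐc[k] B y)
  map_id (x : X) : map (𝒢.id x) = BialgHom.id k (B x)
  map_comp {x y z : X} (g : 𝒢.Hom x y) (h : 𝒢.Hom y z) :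
    map (𝒢.comp g h) = (map h).comp (map g)

variable {k : Type*} [Field k] {X : Type*} {𝒢 : Groupoid.{v} X} {B : X → Type*}
  [∀ x, Ring (B x)] [∀ x, HopfAlgebra k (B x)]

/-- The smash product `(⨁ x, B x) # k𝒢`. Over the target counital subalgebra of `k𝒢`, spanned by the
identities `e_x`, the tensor product `(⨁ x, B x) ⊗ k𝒢` is the direct sum over all morphisms `g` of
the spaces `B (t(g)) # g`, because `a # g = a # e_{t(g)} g = a (e_{t(g)} · 1) # g` is the component
of `a` in `B (t(g))`, followed by `# g`. -/
def SmashProduct (_act : HopfAction k 𝒢 B) : Type _ := Π₀ m : GrpdMor 𝒢, B m.tgt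

namespace SmashProduct

variable (act : HopfAction k 𝒢 B)

instance : AddCommGroup (SmashProduct act) :=
  inferInstanceAs (AddCommGroup (Π₀ m : GrpdMor 𝒢, B m.tgt))

instance : Module k (SmashProduct act) :=
  inferInstanceAs (Module k (Π₀ m : GrpdMor 𝒢, B m.tgt))

/-- The coalgebra structure is that of the direct sum: `Δ(a # g) = (a₁ # g) ⊗ (a₂ # g)` and
`ε(a # g) = ε(a)`. -/
instance : Coalgebra k (SmashProduct act) :=
  inferInstanceAs (Coalgebra k (Π₀ m : GrpdMor 𝒢, B m.tgt))

/-- The element `a # g`, for `g : x → y` and `a ∈ B y`. -/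
def mk {x y : X} (g : 𝒢.Hom x y) : B y →ₗ[k] SmashProduct act :=
  DFinsupp.lsingle (M := fun m : GrpdMor 𝒢 => B m.tgt) (GrpdMor.mk g)

variable {act}

@[elab_as_elim]
theorem induction_on {p : SmashProduct act → Prop} (a : SmashProduct act) (h0 : p 0)
    (hmk : ∀ {x y : X} (g : 𝒢.Hom x y) (b : B y), p (mk act g b))
    (hadd : ∀ a b, p a → p b → p (a + b)) : p a :=
  DFinsupp.induction (p := p) a h0 fun m b _ _ _ hf => hadd _ _ (hmk m.hom b) hf

theorem comul_mk {x y : X} (g : 𝒢.Hom x y) (b : B y) :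
    Coalgebra.comul (R := k) (mk act g b) =
      TensorProduct.map (mk act g) (mk act g) (Coalgebra.comul b) :=
  DFinsupp.comul_single k (GrpdMor 𝒢) (fun m => B m.tgt) (GrpdMor.mk g) b

theorem counit_mk {x y : X} (g : 𝒢.Hom x y) (b : B y) :
    Coalgebra.counit (R := k) (mk act g b) = Coalgebra.counit (R := k) b :=
  DFinsupp.counit_single k (GrpdMor 𝒢) (fun m => B m.tgt) (GrpdMor.mk g) b

variable (act) in
/-- Linear maps out of the smash product are given by a linear map on each `B (t(g)) # g`. -/
def lift {V : Type*} [AddCommGroup V] [Module k V]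
    (f : ∀ m : GrpdMor 𝒢, B m.tgt →ₗ[k] V) : SmashProduct act →ₗ[k] V :=
  DFinsupp.lsum (M := fun m : GrpdMor 𝒢 => B m.tgt) k f

theorem lift_mk {V : Type*} [AddCommGroup V] [Module k V]
    (f : ∀ m : GrpdMor 𝒢, B m.tgt →ₗ[k] V) {x y : X} (g : 𝒢.Hom x y) (b : B y) :
    lift act f (mk act g b) = f ⟨g⟩ b :=
  DFinsupp.lsum_single _ _ _ _

theorem map_id_apply (x : X) (b : B x) : act.map (𝒢.id x) b = b := by
  rw [act.map_id]; rfl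

theorem map_comp_apply {x y z : X} (g : 𝒢.Hom x y) (h : 𝒢.Hom y z) (b : B x) :
    act.map (𝒢.comp g h) b = act.map h (act.map g b) := by
  rw [act.map_comp]; rfl

instance [Fintype X] : One (SmashProduct act) := ⟨∑ x, mk act (𝒢.id x) 1⟩

theorem one_def [Fintype X] : (1 : SmashProduct act) = ∑ x, mk act (𝒢.id x) 1 := rfl

section Mul

variable [DecidableEq X]

variable (act) in
/-- The product of `a # g` and `b # h` is `a (g · b) # gh` if `s(g) = t(h)`, and `0` otherwise.
(In the groupoid, the morphism `gh` of the usual notation is `comp h g`.) -/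
def mulMor (m n : GrpdMor 𝒢) : B m.tgt →ₗ[k] B n.tgt →ₗ[k] SmashProduct act :=
  if e : m.src = n.tgt then
    ((LinearMap.mul k (B m.tgt)).compl₂ (act.map (e ▸ m.hom) : B n.tgt →ₗ[k] B m.tgt)).compr₂
      (mk act (𝒢.comp n.hom (e ▸ m.hom)))
  else 0

variable (act) in
/-- Multiplication of the smash product, as a bilinear map. -/
def mulBilin : SmashProduct act →ₗ[k] SmashProduct act →ₗ[k] SmashProduct act :=
  lift act fun m => (lift act fun n => (mulMor act m n).flip).flip

instance : Mul (SmashProduct act) := ⟨fun a b => mulBilin act a b⟩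

theorem mul_def (a b : SmashProduct act) : a * b = mulBilin act a b := rfl

theorem mk_mul_mk {x y z : X} (g : 𝒢.Hom y z) (h : 𝒢.Hom x y) (a : B z) (b : B y) :
    mk act g a * mk act h b = mk act (𝒢.comp h g) (a * act.map g b) := by
  simp [mul_def, mulBilin, lift_mk, mulMor]

theorem mk_mul_mk_of_ne {w x y z : X} (g : 𝒢.Hom y z) (h : 𝒢.Hom x w) (a : B z) (b : B w)
    (hne : y ≠ w) : mk act g a * mk act h b = 0 := by
  simp [mul_def, mulBilin, lift_mk, mulMor, hne]

variable [Fintype X]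

theorem mk_mul_one {x y : X} (g : 𝒢.Hom x y) (a : B y) :
    mulBilin act (mk act g a) 1 = mk act g a := by
  rw [one_def, map_sum, Finset.sum_eq_single x]
  · rw [← mul_def, mk_mul_mk, 𝒢.id_comp, map_one, mul_one]
  · intro z _ hz
    rw [← mul_def, mk_mul_mk_of_ne _ _ _ _ hz.symm]
  · simp

theorem one_mul_mk {x y : X} (g : 𝒢.Hom x y) (a : B y) :
    mulBilin act 1 (mk act g a) = mk act g a := by
  rw [one_def, map_sum, LinearMap.sum_apply, Finset.sum_eq_single y]
  · rw [← mul_def, mk_mul_mk, 𝒢.comp_id, map_id_apply, one_mul]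
  · intro z _ hz
    rw [← mul_def, mk_mul_mk_of_ne _ _ _ _ hz]
  · simp

/-- The smash product algebra, with `(a # g)(b # h) = a (g · b) # gh` and `1 = ∑ x, 1 # e_x`. -/
instance : Ring (SmashProduct act) where
  __ := (inferInstance : AddCommGroup (SmashProduct act))
  left_distrib a b c := by simp [mul_def]
  right_distrib a b c := by simp [mul_def]
  zero_mul a := by simp [mul_def]
  mul_zero a := by simp [mul_def]
  mul_assoc a b c := by
    have hadd (a a' b) : mulBilin act (a + a') b = mulBilin act a b + mulBilin act a' b := by simp
    have hadd' (a b b') : mulBilin act a (b + b') = mulBilin act a b + mulBilin act a b' := by simp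
    simp only [mul_def]
    induction a using induction_on with
    | h0 => simp
    | hadd a a' ha ha' => simp only [hadd, ha, ha']
    | hmk g a =>
      induction b using induction_on with
      | h0 => simp
      | hadd a a' ha ha' => simp only [hadd, hadd', ha, ha']
      | hmk h b =>
        induction c using induction_on with
        | h0 => simp
        | hadd a a' ha ha' => simp only [hadd', ha, ha']
        | hmk l c =>
          rename_i x y x' y' x'' y''
          simp only [← mul_def]
          by_cases e : x = y'
          · subst e
            by_cases e' : x' = y''
            · subst e'
              simp only [mk_mul_mk, 𝒢.assoc, map_mul, map_comp_apply, mul_assoc]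
            · rw [mk_mul_mk, mk_mul_mk_of_ne _ _ _ _ e', mk_mul_mk_of_ne _ _ _ _ e', mul_def]
              simp
          · rw [mk_mul_mk_of_ne _ _ _ _ e]
            by_cases e' : x' = y''
            · subst e'
              rw [mk_mul_mk, mk_mul_mk_of_ne _ _ _ _ e, mul_def]; simp
            · rw [mk_mul_mk_of_ne _ _ _ _ e']; simp [mul_def]
  one_mul a := by
    rw [mul_def]
    induction a using induction_on with
    | h0 => simp
    | hadd a b ha hb => rw [map_add, ha, hb]
    | hmk g a => exact one_mul_mk g a
  mul_one a := by
    rw [mul_def]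
    induction a using induction_on with
    | h0 => simp
    | hadd a b ha hb => rw [map_add, LinearMap.add_apply, ha, hb]
    | hmk g a => exact mk_mul_one g a

instance : Algebra k (SmashProduct act) :=
  Algebra.ofModule (fun c a b => by simp [mul_def]) (fun c a b => by simp [mul_def])

end Mul

end SmashProduct

section WeakHopfSmash

variable {act : HopfAction k 𝒢 B}

namespace SmashProduct
open Coalgebra

theorem counit_map (x y : X) (g : 𝒢.Hom x y) (b : B x) :
    counit (R := k) (act.map g b) = counit (R := k) b := 
  CoalgHomClass.counit_comp_apply (act.map g) b

theorem comul_map (x y : X) (g : 𝒢.Hom x y) (b : B x) :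
    comul (R := k) (act.map g b) = TensorProduct.map (act.map g : B x →ₗ[k] B y)
      (act.map g : B x →ₗ[k] B y) (comul (R := k) b) :=
  (CoalgHomClass.map_comp_comul_apply (act.map g) b).symm

theorem counit_conv {C : Type*} [AddCommGroup C] [Module k C] [Coalgebra k C] (c : C) (r s : k) :
    LinearMap.mul' k k (TensorProduct.map (r • counit) (s • counit) (comul c)) =
      r * s * counit (R := k) c := by
  have key : ∀ t : C ⊗[k] C, LinearMap.mul' k k (TensorProduct.map (r • counit) (s • counit) t) =
      r * s * counit (R := k) (TensorProduct.lid k C (counit.rTensor C t)) := by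
    intro t
    induction t using TensorProduct.induction_on with
    | zero => simp
    | add x y hx hy => simp only [map_add, hx, hy, mul_add]
    | tmul x y => simp; ring
  rw [key, rTensor_counit_comul]; simp

theorem mulLeft_add' {A : Type*} [Ring A] [Algebra k A] (a b : A) :
    LinearMap.mulLeft k (a + b) = LinearMap.mulLeft k a + LinearMap.mulLeft k b := by
  ext; simp [add_mul]

theorem mulRight_add' {A : Type*} [Ring A] [Algebra k A] (a b : A) :
    LinearMap.mulRight k (a + b) = LinearMap.mulRight k a + LinearMap.mulRight k b := by
  ext; simp [mul_add]

variable [DecidableEq X] [Fintype X]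

variable (act) in
/-- The idempotent `f_x = 1 # e_x`. -/
def base (x : X) : SmashProduct act := mk act (𝒢.id x) 1

theorem base_mul_base (x y : X) :
    base act x * base act y = if x = y then base act x else 0 := by
  split_ifs with h
  · subst h; simp [base, mk_mul_mk, 𝒢.id_comp]
  · exact mk_mul_mk_of_ne _ _ _ _ h

theorem comul_base (x : X) : comul (R := k) (base act x) = base act x ⊗ₜ base act x := by
  simp [base, comul_mk, Algebra.TensorProduct.one_def]

theorem counit_base (x : X) : counit (R := k) (base act x) = 1 := by
  simp [base, counit_mk]

theorem comul_one' : comul (R := k) (1 : SmashProduct act) = ∑ x, base act x ⊗ₜ base act x := by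
  rw [one_def, map_sum]; exact Finset.sum_congr rfl fun x _ => comul_base x

theorem counit_mk_mul_mk {w x y z : X} (g : 𝒢.Hom y z) (h : 𝒢.Hom x w) (a : B z) (b : B w) :
    counit (R := k) (mk act g a * mk act h b) =
      if y = w then counit (R := k) a * counit (R := k) b else 0 := by
  split_ifs with e
  · subst e; rw [mk_mul_mk, counit_mk, Bialgebra.counit_mul, counit_map]
  · rw [mk_mul_mk_of_ne _ _ _ _ e, map_zero]

theorem map_mk_mul_map_mk {x y z : X} (g : 𝒢.Hom y z) (h : 𝒢.Hom x y)
    (s : B z ⊗[k] B z) (t : B y ⊗[k] B y) :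
    TensorProduct.map (mk act g) (mk act g) s * TensorProduct.map (mk act h) (mk act h) t =
      TensorProduct.map (mk act (𝒢.comp h g)) (mk act (𝒢.comp h g))
        (s * TensorProduct.map (act.map g : B y →ₗ[k] B z) (act.map g : B y →ₗ[k] B z) t) := by
  induction s using TensorProduct.induction_on with
  | zero => simp
  | add s s' hs hs' => simp [add_mul, hs, hs']
  | tmul u v =>
    induction t using TensorProduct.induction_on with
    | zero => simp
    | add s s' hs hs' => simp only [map_add, mul_add, hs, hs']
    | tmul u' v' => simp [mk_mul_mk]

theorem map_mk_mul_map_mk_of_ne {w x y z : X} (g : 𝒢.Hom y z) (h : 𝒢.Hom x w)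
    (s : B z ⊗[k] B z) (t : B w ⊗[k] B w) (hne : y ≠ w) :
    TensorProduct.map (mk act g) (mk act g) s *
      TensorProduct.map (mk act h) (mk act h) t = 0 := by
  induction s using TensorProduct.induction_on with
  | zero => simp
  | add s s' hs hs' => simp [add_mul, hs, hs']
  | tmul u v =>
    induction t using TensorProduct.induction_on with
    | zero => simp
    | add s s' hs hs' => simp only [map_add, mul_add, hs, hs', add_zero]
    | tmul u' v' => simp [mk_mul_mk_of_ne _ _ _ _ hne]

theorem comul_mul_aux (a b : SmashProduct act) :
    comul (R := k) (a * b) = comul (R := k) a * comul (R := k) b := by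
  induction a using induction_on with
  | h0 => simp
  | hadd a a' ha ha' => simp [add_mul, ha, ha']
  | hmk g a =>
    induction b using induction_on with
    | h0 => simp
    | hadd a a' ha ha' => simp [mul_add, ha, ha']
    | hmk h b =>
      rename_i x y x' y'
      by_cases e : x = y'
      · subst e
        rw [mk_mul_mk, comul_mk, comul_mk, comul_mk, map_mk_mul_map_mk, Bialgebra.comul_mul,
          comul_map]
      · rw [mk_mul_mk_of_ne _ _ _ _ e, comul_mk, comul_mk, map_mk_mul_map_mk_of_ne _ _ _ _ e,
          map_zero]

theorem counit_mulLeft_mk {w x y z : X} (g : 𝒢.Hom y z) (h : 𝒢.Hom x w) (a : B z) :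
    (counit ∘ₗ LinearMap.mulLeft k (mk act g a)) ∘ₗ mk act h =
      (if y = w then counit (R := k) a else 0) • counit := by
  ext b
  simp only [LinearMap.comp_apply, LinearMap.mulLeft_apply, counit_mk_mul_mk, LinearMap.smul_apply]
  split_ifs <;> simp

theorem counit_mulRight_mk {w x y z : X} (g : 𝒢.Hom y z) (h : 𝒢.Hom x w) (b : B w) :
    (counit ∘ₗ LinearMap.mulRight k (mk act h b)) ∘ₗ mk act g =
      (if y = w then counit (R := k) b else 0) • counit := by
  ext a
  simp only [LinearMap.comp_apply, LinearMap.mulRight_apply, counit_mk_mul_mk,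
    LinearMap.smul_apply]
  split_ifs <;> simp [mul_comm]

theorem counit_triple {x y x' y' x'' y'' : X} (g : 𝒢.Hom x y) (h : 𝒢.Hom x' y')
    (l : 𝒢.Hom x'' y'') (a : B y) (b : B y') (c : B y'') :
    counit (R := k) (mk act g a * mk act h b * mk act l c) =
      (if x = y' then counit (R := k) a else 0) * (if x' = y'' then counit (R := k) c else 0) *
        counit (R := k) b := by
  by_cases e : x = y'
  · subst e
    rw [mk_mul_mk, counit_mk_mul_mk, if_pos rfl, Bialgebra.counit_mul, counit_map]
    split_ifs <;> ring
  · rw [mk_mul_mk_of_ne _ _ _ _ e, if_neg e]; simp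

theorem counit_mul_mul_aux (a b c : SmashProduct act) : counit (R := k) (a * b * c) =
    LinearMap.mul' k k (TensorProduct.map (counit ∘ₗ LinearMap.mulLeft k a)
      (counit ∘ₗ LinearMap.mulRight k c) (comul b)) := by
  induction a using induction_on with
  | h0 => simp
  | hadd a a' ha ha' =>
    simp only [add_mul, map_add, ha, ha', mulLeft_add', LinearMap.comp_add,
      TensorProduct.map_add_left, LinearMap.add_apply]
  | hmk g a =>
    induction c using induction_on with
    | h0 => simp
    | hadd a a' ha ha' =>
      simp only [mul_add, map_add, ha, ha', mulRight_add', LinearMap.comp_add,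
        TensorProduct.map_add_right, LinearMap.add_apply]
    | hmk l c =>
      induction b using induction_on with
      | h0 => simp
      | hadd a a' ha ha' => simp only [mul_add, add_mul, map_add, ha, ha']
      | hmk h b =>
        rw [comul_mk, ← LinearMap.comp_apply (TensorProduct.map _ _), ← TensorProduct.map_comp,
          counit_mulLeft_mk, counit_mulRight_mk, counit_conv, counit_triple]

theorem counit_mul_mul_swap_aux (a b c : SmashProduct act) : counit (R := k) (a * b * c) =
    LinearMap.mul' k k (TensorProduct.map (counit ∘ₗ LinearMap.mulRight k c)
      (counit ∘ₗ LinearMap.mulLeft k a) (comul b)) := by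
  induction a using induction_on with
  | h0 => simp
  | hadd a a' ha ha' =>
    simp only [add_mul, map_add, ha, ha', mulLeft_add', LinearMap.comp_add,
      TensorProduct.map_add_right, LinearMap.add_apply]
  | hmk g a =>
    induction c using induction_on with
    | h0 => simp
    | hadd a a' ha ha' =>
      simp only [mul_add, map_add, ha, ha', mulRight_add', LinearMap.comp_add,
        TensorProduct.map_add_left, LinearMap.add_apply]
    | hmk l c =>
      induction b using induction_on with
      | h0 => simp
      | hadd a a' ha ha' => simp only [mul_add, add_mul, map_add, ha, ha']
      | hmk h b =>
        rw [comul_mk, ← LinearMap.comp_apply (TensorProduct.map _ _), ← TensorProduct.map_comp,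
          counit_mulLeft_mk, counit_mulRight_mk, counit_conv, counit_triple]
        ring

theorem comul_comul_one_aux :
    TensorProduct.assoc k _ _ _ (comul.rTensor _ (comul (R := k) (1 : SmashProduct act))) =
      ∑ x, base act x ⊗ₜ (base act x ⊗ₜ base act x) := by
  simp [comul_one', comul_base]

/-- The smash product weak bialgebra. -/
instance : WeakBialgebra k (SmashProduct act) where
  comul_mul' := comul_mul_aux
  counit_mul_mul := counit_mul_mul_aux
  counit_mul_mul_swap := counit_mul_mul_swap_aux
  comul_comul_one := by
    rw [comul_comul_one_aux, comul_one']
    simp [TensorProduct.sum_tmul, TensorProduct.tmul_sum, Finset.sum_mul_sum, base_mul_base,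
      TensorProduct.ite_tmul, TensorProduct.tmul_ite]
  comul_comul_one_swap := by
    rw [comul_comul_one_aux, comul_one']
    simp [TensorProduct.sum_tmul, TensorProduct.tmul_sum, Finset.sum_mul_sum, base_mul_base,
      TensorProduct.ite_tmul, TensorProduct.tmul_ite]

theorem sourceCounital_eq (h : SmashProduct act) :
    sourceCounital k h = ∑ x, counit (R := k) (h * base act x) • base act x := by
  simp [sourceCounital, comul_one']

theorem targetCounital_eq (h : SmashProduct act) :
    targetCounital k h = ∑ x, counit (R := k) (base act x * h) • base act x := by
  simp [targetCounital, comul_one']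

theorem sourceCounital_mk {x y : X} (g : 𝒢.Hom x y) (a : B y) :
    sourceCounital k (mk act g a) = counit (R := k) a • base act x := by
  rw [sourceCounital_eq]
  simp [base, counit_mk_mul_mk, ite_smul]

theorem targetCounital_mk {x y : X} (g : 𝒢.Hom x y) (a : B y) :
    targetCounital k (mk act g a) = counit (R := k) a • base act y := by
  rw [targetCounital_eq]
  simp [base, counit_mk_mul_mk, ite_smul]

variable (act) in
/-- The antipode `S(a # g) = (1 # g⁻¹)(S(a) # 1) = g⁻¹ · S(a) # g⁻¹`. -/
def antipode : SmashProduct act →ₗ[k] SmashProduct act :=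
  lift act fun m => mk act (𝒢.inv m.hom) ∘ₗ (act.map (𝒢.inv m.hom) : B m.tgt →ₗ[k] B m.src) ∘ₗ
    HopfAlgebra.antipode k

theorem antipode_mk {x y : X} (g : 𝒢.Hom x y) (a : B y) : antipode act (mk act g a) =
    mk act (𝒢.inv g) (act.map (𝒢.inv g) (HopfAlgebra.antipode k a)) := by
  simp [antipode, lift_mk]

theorem antipode_mul_aux (h : SmashProduct act) :
    LinearMap.mul' k _ ((antipode act).rTensor _ (comul h)) = sourceCounital k h := by
  induction h using induction_on with
  | h0 => simp [sourceCounital_eq]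
  | hadd a b ha hb =>
    rw [map_add, map_add, map_add, ha, hb]
    simp [sourceCounital_eq, add_mul, add_smul, Finset.sum_add_distrib]
  | hmk g a =>
    rename_i x y
    have key : ∀ s : B y ⊗[k] B y, LinearMap.mul' k _
        ((antipode act).rTensor _ (TensorProduct.map (mk act g) (mk act g) s)) =
        mk act (𝒢.id x) (act.map (𝒢.inv g)
          (LinearMap.mul' k _ ((HopfAlgebra.antipode k).rTensor _ s))) := by
      intro s
      induction s using TensorProduct.induction_on with
      | zero => simp
      | add u v hu hv => simp only [map_add, hu, hv]
      | tmul u v => simp [antipode_mk, mk_mul_mk]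
    rw [comul_mk, key, HopfAlgebra.mul_antipode_rTensor_comul_apply, sourceCounital_mk,
      Algebra.algebraMap_eq_smul_one, map_smul, map_smul, map_one, base]

theorem mul_antipode_aux (h : SmashProduct act) :
    LinearMap.mul' k _ ((antipode act).lTensor _ (comul h)) = targetCounital k h := by
  induction h using induction_on with
  | h0 => simp [targetCounital_eq]
  | hadd a b ha hb =>
    rw [map_add, map_add, map_add, ha, hb]
    simp [targetCounital_eq, mul_add, add_smul, Finset.sum_add_distrib]
  | hmk g a =>
    rename_i x y
    have key : ∀ s : B y ⊗[k] B y, LinearMap.mul' k _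
        ((antipode act).lTensor _ (TensorProduct.map (mk act g) (mk act g) s)) =
        mk act (𝒢.id y) (LinearMap.mul' k _ ((HopfAlgebra.antipode k).lTensor _ s)) := by
      intro s
      induction s using TensorProduct.induction_on with
      | zero => simp
      | add u v hu hv => simp only [map_add, hu, hv]
      | tmul u v =>
        simp only [TensorProduct.map_tmul, LinearMap.lTensor_tmul, antipode_mk,
          LinearMap.mul'_apply, mk_mul_mk, ← map_comp_apply, 𝒢.inv_comp, map_id_apply]
    rw [comul_mk, key, HopfAlgebra.mul_antipode_lTensor_comul_apply, targetCounital_mk,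
      Algebra.algebraMap_eq_smul_one, map_smul, base]

theorem antipode_mul_antipode_aux (h : SmashProduct act) :
    LinearMap.mul' k _ (TensorProduct.map (LinearMap.mul' k _ ∘ₗ (antipode act).rTensor _)
      (antipode act) (comul.rTensor _ (comul h))) = antipode act h := by
  induction h using induction_on with
  | h0 => simp
  | hadd a b ha hb => simp only [map_add, ha, hb]
  | hmk g a =>
    rename_i x y
    have key : ∀ s : B y ⊗[k] B y, LinearMap.mul' k _
        (TensorProduct.map (LinearMap.mul' k _ ∘ₗ (antipode act).rTensor _)
          (antipode act) (comul.rTensor _ (TensorProduct.map (mk act g) (mk act g) s))) =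
        antipode act (mk act g (TensorProduct.lid k _ (counit.rTensor _ s))) := by
      intro s
      induction s using TensorProduct.induction_on with
      | zero => simp
      | add u v hu hv => simp only [map_add, hu, hv]
      | tmul u v =>
        simp only [TensorProduct.map_tmul, LinearMap.rTensor_tmul, LinearMap.mul'_apply,
          LinearMap.comp_apply, antipode_mul_aux, sourceCounital_mk, TensorProduct.lid_tmul,
          map_smul, antipode_mk, smul_mul_assoc, base, mk_mul_mk, map_id_apply, one_mul,
          𝒢.comp_id]
    rw [comul_mk, key, rTensor_counit_comul, TensorProduct.lid_tmul, one_smul]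

/-- The smash product weak Hopf algebra. -/
instance : WeakHopfAlgebra k (SmashProduct act) where
  weakAntipode := antipode act
  antipode_mul := antipode_mul_aux
  mul_antipode := mul_antipode_aux
  antipode_mul_antipode := antipode_mul_antipode_aux

/-- The elements `f_x = 1 # e_x` make the smash product an `X`-weak Hopf algebra. -/
theorem isXBase_base : IsXBase k (base act) where
  complete :=
    { idem := fun x => by simp [IsIdempotentElem, base_mul_base]
      ortho := fun x y h => by simp [base_mul_base, h]
      complete := rfl }
  ne_zero x h := by
    have := counit_base (act := act) x
    rw [h, map_zero] at this
    exact zero_ne_one this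
  grouplike x := ⟨counit_base x, comul_base x⟩

end SmashProduct

end WeakHopfSmash

section GroupoidAlgebra

variable [DecidableEq X] [Fintype X]

variable (k 𝒢) in
/-- The trivial action of a groupoid `𝒢` on the family of Hopf algebras constantly equal to `k`. -/
def trivialAction : HopfAction k 𝒢 (fun _ => k) where
  map _ := BialgHom.id k k
  map_id _ := rfl
  map_comp _ _ := rfl

variable (k 𝒢) in
/-- The groupoid algebra `k𝒢`, as an `X`-weak Hopf algebra: it has the morphisms
`mk g 1 = 1 # g` as a basis; `g h` is the composite if it is defined and `0` otherwise,
`1 = ∑ x, e_x`, `Δ(g) = g ⊗ g`, `ε(g) = 1`, `S(g) = g⁻¹`. -/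
abbrev GroupoidAlgebra : Type _ := SmashProduct (trivialAction k 𝒢)

/-- An `X`-groupoid homomorphism: a functor that is the identity on the object set `X`. -/
structure XGroupoidHom {X : Type*} (𝒢 : Groupoid.{v} X) (𝒢' : Groupoid.{v'} X) where
  map {x y : X} : 𝒢.Hom x y → 𝒢'.Hom x y
  map_id (x : X) : map (𝒢.id x) = 𝒢'.id x
  map_comp {x y z : X} (g : 𝒢.Hom x y) (h : 𝒢.Hom y z) :
    map (𝒢.comp g h) = 𝒢'.comp (map g) (map h)

open SmashProduct

/-- The algebra map `π̃ : k𝒢 → k𝒢'`, `g ↦ π(g)`, induced by an `X`-groupoid homomorphism `π`. -/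
def groupoidAlgebraMap {𝒢' : Groupoid.{v'} X} (π : XGroupoidHom 𝒢 𝒢') :
    GroupoidAlgebra k 𝒢 →ₐ[k] GroupoidAlgebra k 𝒢' :=
  AlgHom.ofLinearMap
    (SmashProduct.lift (trivialAction k 𝒢) fun m => mk (trivialAction k 𝒢') (π.map m.hom))
    (by simp [one_def, lift_mk, π.map_id])
    (fun a b => by
      induction a using induction_on with
      | h0 => simp
      | hadd a a' ha ha' => simp only [add_mul, map_add, ha, ha']
      | hmk g a =>
        induction b using induction_on with
        | h0 => simp
        | hadd a a' ha ha' => simp only [mul_add, map_add, ha, ha']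
        | hmk h b =>
          rename_i x y x' y'
          by_cases e : x = y'
          · subst e
            simp only [mk_mul_mk, lift_mk, π.map_comp]
            rfl
          · simp only [mk_mul_mk_of_ne _ _ _ _ e, lift_mk, map_zero])

/-- The `k𝒢`-module structure on `⨁ x, B x` given by an action of `𝒢` on the family `(B x)`:
a morphism `g : x → y` acts on `B x` by `map g : B x → B y`, and by `0` on the other summands. -/
def actionRep (act : HopfAction k 𝒢 B) :
    GroupoidAlgebra k 𝒢 →ₐ[k] Module.End k (∀ x, B x) :=
  AlgHom.ofLinearMap
    (SmashProduct.lift (trivialAction k 𝒢) fun m => LinearMap.toSpanSingleton k _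
      (LinearMap.single k B m.tgt ∘ₗ (act.map m.hom : B m.src →ₗ[k] B m.tgt) ∘ₗ
        LinearMap.proj m.src))
    (by
      rw [one_def, map_sum]
      ext x b y
      simp [lift_mk, map_id_apply, Finset.sum_apply])
    (fun a b => by
      induction a using induction_on with
      | h0 => simp
      | hadd a a' ha ha' => simp only [add_mul, map_add, ha, ha']
      | hmk g a =>
        induction b using induction_on with
        | h0 => simp
        | hadd a a' ha ha' => simp only [mul_add, map_add, ha, ha']
        | hmk h b =>
          rename_i x y x' y'
          by_cases e : x = y'
          · subst e
            simp only [mk_mul_mk, lift_mk]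
            refine LinearMap.ext fun m => ?_
            simp [map_comp_apply, mul_smul, trivialAction, smul_comm a b]
          · rw [mk_mul_mk_of_ne _ _ _ _ e, map_zero, lift_mk, lift_mk]
            refine LinearMap.ext fun m => ?_
            simp [e])

end GroupoidAlgebra

/-! ## Actions of groupoids on `X`-Lie algebroids, and `U_X(𝔊) # k𝒢` -/

section LieAlgebroid

/-- An action of the groupoid `𝒢` on the `X`-Lie algebroid `𝔊 = ⨁ x, 𝔤 x`: a functor with
`x ↦ 𝔤 x`, with values in Lie algebra maps. Each `map g` is invertible, with inverse
`map g⁻¹`. In `U_X(𝔊) # k𝒢` this action is conjugation: `g p g⁻¹ = map g p`. -/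
structure LieAction (k : Type*) [Field k] {X : Type*} (𝒢 : Groupoid.{v} X) (𝔤 : X → Type*)
    [∀ x, LieRing (𝔤 x)] [∀ x, LieAlgebra k (𝔤 x)] where
  map {x y : X} : 𝒢.Hom x y → (𝔤 x →ₗ⁅k⁆ 𝔤 y)
  map_id (x : X) : map (𝒢.id x) = LieHom.id
  map_comp {x y z : X} (g : 𝒢.Hom x y) (h : 𝒢.Hom y z) :
    map (𝒢.comp g h) = (map h).comp (map g)

variable {𝔤 𝔥 : X → Type*} [∀ x, LieRing (𝔤 x)] [∀ x, LieAlgebra k (𝔤 x)]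
  [∀ x, LieRing (𝔥 x)] [∀ x, LieAlgebra k (𝔥 x)]

/-- The induced action of `𝒢` on the family `U(𝔤 x)`, i.e. on `U_X(𝔊) = ⨁ x, U(𝔤 x)`. -/
def LieAction.toHopfAction (α : LieAction k 𝒢 𝔤) :
    HopfAction k 𝒢 (fun x => UniversalEnvelopingAlgebra k (𝔤 x)) where
  map g := univEnvMapBialg (α.map g)
  map_id x := by rw [α.map_id, univEnvMapBialg_id]
  map_comp g h := by rw [α.map_comp, univEnvMapBialg_comp]

/-- The weak Hopf algebra `U_X(𝔊) # k𝒢`. -/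
abbrev LieAction.Smash (α : LieAction k 𝒢 𝔤) : Type _ := SmashProduct α.toHopfAction

/-- The idempotents `f_x = 1_{U(𝔤 x)} # e_x` of `U_X(𝔊) # k𝒢`. -/
abbrev LieAction.base (α : LieAction k 𝒢 𝔤) (x : X) : α.Smash :=
  SmashProduct.base α.toHopfAction x

variable (k 𝔤 𝔥) in
/-- An `X`-Lie algebroid homomorphism `⨁ x, 𝔤 x → ⨁ x, 𝔥 x`: a family of Lie algebra maps
`𝔤 x → 𝔥 x`. -/
abbrev XLieHom : Type _ := ∀ x, 𝔤 x →ₗ⁅k⁆ 𝔥 x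

/-- The algebra map `τ̃ : U_X(𝔊) → U_X(ℌ)` induced by an `X`-Lie algebroid homomorphism `τ`, where
`U_X(𝔊) = ⨁ x, U(𝔤 x)` is the product algebra (`X` is finite). -/
def univEnvXMap (τ : XLieHom k 𝔤 𝔥) :
    (∀ x, UniversalEnvelopingAlgebra k (𝔤 x)) →ₐ[k] (∀ x, UniversalEnvelopingAlgebra k (𝔥 x)) :=
  AlgHom.pi fun x => (univEnvMap (τ x)).comp (Pi.evalAlgHom k _ x)

end LieAlgebroid

end Smash

/-! ## Decomposable algebras, their automorphism groupoid and their derivations -/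

section Decomposition

/-- An `X`-decomposition `A = ⨁ x, A_x` of the algebra `A`: a family of unital algebras (some of
which may be zero), with an isomorphism of `A` onto their direct sum (`X` is finite). -/
structure XDecomposition (k : Type*) [Field k] (X : Type*) (A : Type u) [Ring A]
    [Algebra k A] where
  comp : X → Type u
  [ring (x : X) : Ring (comp x)]
  [algebra (x : X) : Algebra k (comp x)]
  equiv : A ≃ₐ[k] ∀ x, comp x

attribute [instance] XDecomposition.ring XDecomposition.algebra

namespace XDecomposition

variable {k : Type*} [Field k] {X : Type*} {A : Type u} [Ring A] [Algebra k A]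
  (D : XDecomposition k X A)

/-- The component `A_x`, as a subspace of `A`. -/
def component [DecidableEq X] (x : X) : Submodule k A :=
  LinearMap.range (D.equiv.symm.toLinearMap ∘ₗ LinearMap.single k D.comp x)

/-- `A_x = (f_x · 1_A) A` for all `x`, where `A` is a module algebra over a weak Hopf algebra `H`
with distinguished elements `f_x`. -/
def CompatibleWith [DecidableEq X] {H : Type*} [Ring H] [Algebra k H] [WeakHopfAlgebra k H]
    (M : ModuleAlgebra k H A) (f : X → H) : Prop :=
  ∀ x, (D.component x : Set A) = Set.range fun a => M.ρ (f x) 1 * a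

/-- The `X`-algebra automorphism groupoid of `A = ⨁ x, A_x`: the object set is `X` (the object `x`
stands for `A_x`) and the morphisms `x → y` are the isomorphisms of unital algebras
`A_x → A_y`. -/
@[reducible] def autGroupoid : Groupoid.{u} X where
  Hom x y := D.comp x ≃ₐ[k] D.comp y
  id _ := AlgEquiv.refl
  comp α β := α.trans β
  inv α := α.symm
  inv_comp α := by ext; simp
  comp_inv α := by ext; simp

/-- The components `Der(A_x)` of the `X`-Lie algebroid `Der_X(A) = ⨁ x, Der(A_x)`. -/
abbrev Der (x : X) : Type u := derLie k (D.comp x)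

/-- The action of the automorphism groupoid on `Der_X(A)` by conjugation. -/
def derAction : LieAction k D.autGroupoid D.Der where
  map α := derConj α
  map_id x := by ext; rfl
  map_comp α β := by ext; rfl

/-- For the given `X`-decomposition of `A`, there are an `X`-groupoid
homomorphism `π` from `𝒢` to the automorphism groupoid of `A` and an `X`-Lie algebroid
homomorphism `τ : 𝔊 → Der_X(A)` such that `τ̃ : U_X(𝔊) → U_X(Der_X(A))` is `π̃`-linear, i.e.
`τ̃(r · m) = π̃(r) · τ̃(m)` for all `r` in `k𝒢` and `m` in `U_X(𝔊)`. -/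
def HasLinearHoms [DecidableEq X] [Fintype X] {𝒢 : Groupoid.{v} X} {𝔤 : X → Type w}
    [∀ x, LieRing (𝔤 x)] [∀ x, LieAlgebra k (𝔤 x)] (α : LieAction k 𝒢 𝔤) : Prop :=
  ∃ (π : XGroupoidHom 𝒢 D.autGroupoid) (τ : XLieHom k 𝔤 D.Der),
    ∀ (r : GroupoidAlgebra k 𝒢) (m : ∀ x, UniversalEnvelopingAlgebra k (𝔤 x)),
      univEnvXMap τ (actionRep α.toHopfAction r m) =
        actionRep D.derAction.toHopfAction (groupoidAlgebraMap π r) (univEnvXMap τ m)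

end XDecomposition

end Decomposition

end

noncomputable section

/-! ## The action of `U(Der(A))` on `A` -/

section DerEnvelope

attribute [local instance] LieRing.ofAssociativeRing

open UniversalEnvelopingAlgebra Coalgebra

variable {k : Type*} [Field k] {C : Type*} [Ring C] [Algebra k C]

/-! For a fixed decomposition, `U_X(Der_X(A)) # k(Aut_X(A))` acts canonically on `A`: if `g : A_x →
A_y`, then `a # g` projects to `A_x`, applies `g`, and lets `a ∈ U(Der(A_y))` act on `A_y`. This is
a module algebra structure (`canonicalModuleAlgebra`): automorphisms are multiplicative, derivations
satisfy the Leibniz rule and kill `1`, and both properties pass to products in `U(Der(A_y))`. A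
homomorphism `φ` as in (c) pulls this structure back to `H`, so (c) gives (a) without any
determination of the grouplike or primitive elements of the target.

Conversely, let `H` act on `A`. The `f_x` are orthogonal grouplike idempotents with sum `1`, so they
act as orthogonal multiplicative projections; hence the `f_x · 1` are central idempotents and cut
`A` into the `A_x` (`exists_compatibleWith`). Once `f_x` is known to be the projection to `A_x`
(`CompatibleWith.act_base`), an element `a # g` with `g : x → y` is determined by a map `A_x → A_y`,
and composition of such maps follows multiplication in `H` (`compress_compress`). The coproduct
tells what these maps are: `1 # g` is grouplike and gives an algebra map, inverted by `1 # g⁻¹`; `p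
# e_x` is primitive relative to `f_x` and gives a derivation. The relation `g p g⁻¹ = g · p` in `H`
becomes the compatibility of `π` and `τ`.

Finally, that compatibility is exactly what makes `a # g ↦ τ̃(a) # π(g)` multiplicative
(`smashMapLinear_mul`), so (b) gives (c). All three implications keep the decomposition fixed, which
also proves the refined statement. -/

variable (k C) in
/-- The action of `U(Der(C))` on `C` that extends the action of `Der(C)`. -/
def derEnvRep : UniversalEnvelopingAlgebra k (derLie k C) →ₐ[k] Module.End k C :=
  lift k (derLie k C).incl

@[simp] theorem derEnvRep_ι (E : derLie k C) : derEnvRep k C (ι k E) = E.1 :=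
  lift_ι_apply _ _ _

/-- Conjugation by `β` is an algebra isomorphism `End(C) → End(C')`, so it is enough to compare two
algebra maps on the generators `Der(C)`, where `derConj` is conjugation by definition. This makes
the canonical action multiplicative. -/
theorem derEnvRep_conj {C' : Type*} [Ring C'] [Algebra k C'] (β : C ≃ₐ[k] C')
    (a : UniversalEnvelopingAlgebra k (derLie k C)) (c : C) :
    derEnvRep k C' (univEnvMapBialg (derConj β) a) (β c) = β (derEnvRep k C a c) := by
  let f := (derEnvRep k C').comp (univEnvMapBialg (derConj β) :
    UniversalEnvelopingAlgebra k (derLie k C) →ₐ[k] UniversalEnvelopingAlgebra k (derLie k C'))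
  have h : f = (β.toLinearEquiv.conjAlgEquiv k).toAlgHom.comp (derEnvRep k C) := by
    refine univEnv_algHom_ext k fun E => LinearMap.ext fun c => ?_
    change derEnvRep k C' (univEnvMapBialg (derConj β) (ι k E)) c = β (derEnvRep k C (ι k E) _)
    rw [univEnvMapBialg_ι, derEnvRep_ι, derEnvRep_ι]
    rfl
  have := LinearMap.congr_fun (AlgHom.congr_fun h a) (β c)
  simpa [f] using this

/-- `a · (uv) = (a₁ · u)(a₂ · v)`, as an equation between linear maps on `C ⊗ C`. -/
theorem derEnvRep_comp_mul' (a : UniversalEnvelopingAlgebra k (derLie k C)) :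
    derEnvRep k C a ∘ₗ LinearMap.mul' k C = LinearMap.mul' k C ∘ₗ
      Module.endTensorEndAlgHom (R := k) (S := k) (A := k)
        (Algebra.TensorProduct.map (derEnvRep k C) (derEnvRep k C) (comul a)) := by
  let Ψ : UniversalEnvelopingAlgebra k (derLie k C) →ₐ[k] Module.End k (C ⊗[k] C) :=
    (Module.endTensorEndAlgHom (R := k) (S := k) (A := k)).comp
      ((Algebra.TensorProduct.map (derEnvRep k C) (derEnvRep k C)).comp
        (Bialgebra.comulAlgHom k _))
  -- The equation says that `mul'` intertwines two representations of `U(Der(C))`, on `C ⊗ C` and on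
  -- `C`. The elements it intertwines form a subalgebra, so derivations suffice, and for these it is
  -- the Leibniz rule.
  let T : Subalgebra k (UniversalEnvelopingAlgebra k (derLie k C)) :=
    { carrier := {a | derEnvRep k C a ∘ₗ LinearMap.mul' k C = LinearMap.mul' k C ∘ₗ Ψ a}
      mul_mem' := fun {a b} ha hb => by
        simp only [Set.mem_ofPred_eq] at ha hb ⊢
        rw [map_mul, map_mul, Module.End.mul_eq_comp, Module.End.mul_eq_comp, LinearMap.comp_assoc,
          hb, ← LinearMap.comp_assoc, ha, LinearMap.comp_assoc]
      add_mem' := fun {a b} ha hb => by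
        simp only [Set.mem_ofPred_eq] at ha hb ⊢
        rw [map_add, map_add, LinearMap.add_comp, ha, hb, LinearMap.comp_add]
      algebraMap_mem' := fun c => by
        simp only [Set.mem_ofPred_eq, AlgHom.commutes]
        ext; simp [Algebra.algebraMap_eq_smul_one] }
  refine univEnv_induction k T (fun E => ?_) a
  change derEnvRep k C _ ∘ₗ LinearMap.mul' k C = LinearMap.mul' k C ∘ₗ
      Module.endTensorEndAlgHom (R := k) (S := k) (A := k)
        (Algebra.TensorProduct.map (derEnvRep k C) (derEnvRep k C) (univEnvComul k _ (ι k E)))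
  have hE : ∀ a b, E.1 (a * b) = a * E.1 b + E.1 a * b := E.2
  rw [univEnvComul_ι, map_add, map_add, Algebra.TensorProduct.map_tmul,
    Algebra.TensorProduct.map_tmul, derEnvRep_ι, map_one]
  ext u v
  exact (hE u v).trans (add_comm _ _)

/-- The preceding operator identity evaluated at `c ⊗ d`, in the shape of `ModuleAlgebra.act_mul`.
-/
theorem derEnvRep_mul (a : UniversalEnvelopingAlgebra k (derLie k C)) (c d : C) :
    derEnvRep k C a (c * d) = LinearMap.mul' k C (TensorProduct.map
      ((derEnvRep k C).toLinearMap.flip c) ((derEnvRep k C).toLinearMap.flip d) (comul a)) := by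
  have key : ∀ t : UniversalEnvelopingAlgebra k (derLie k C) ⊗[k] _,
      Module.endTensorEndAlgHom (R := k) (S := k) (A := k)
        (Algebra.TensorProduct.map (derEnvRep k C) (derEnvRep k C) t) (c ⊗ₜ d) =
      TensorProduct.map
        ((derEnvRep k C).toLinearMap.flip c) ((derEnvRep k C).toLinearMap.flip d) t := by
    intro t
    induction t using TensorProduct.induction_on with
    | zero => simp
    | add s t hs ht => simp only [map_add, LinearMap.add_apply, hs, ht]
    | tmul s t => rfl
  rw [← key]
  exact LinearMap.congr_fun (derEnvRep_comp_mul' a) (c ⊗ₜ d)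

theorem derEnvRep_one (a : UniversalEnvelopingAlgebra k (derLie k C)) :
    derEnvRep k C a 1 = counit (R := k) a • 1 := by
  let T : Subalgebra k (UniversalEnvelopingAlgebra k (derLie k C)) :=
    { carrier := {a | derEnvRep k C a 1 = counit (R := k) a • 1}
      mul_mem' := fun {a b} ha hb => by
        simp only [Set.mem_ofPred_eq] at ha hb ⊢
        rw [map_mul, Module.End.mul_apply, hb, map_smul, ha, Bialgebra.counit_mul, smul_smul,
          mul_comm]
      add_mem' := fun {a b} ha hb => by
        simp only [Set.mem_ofPred_eq] at ha hb ⊢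
        rw [map_add, LinearMap.add_apply, ha, hb, map_add, add_smul]
      algebraMap_mem' := fun c => by
        simp [Algebra.algebraMap_eq_smul_one] }
  refine univEnv_induction k T (fun E => ?_) a
  change derEnvRep k C _ 1 = univEnvCounit k _ (ι k E) • 1
  have hE : ∀ a b, E.1 (a * b) = a * E.1 b + E.1 a * b := E.2
  have := hE 1 1
  -- `E(1) = E(1) + E(1)`, so a derivation kills `1`.
  simp only [mul_one, one_mul, left_eq_add] at this
  rw [derEnvRep_ι, univEnvCounit_ι, this, zero_smul]

end DerEnvelope

/-! ## Module algebra structures and decompositions -/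

namespace XDecomposition

open Coalgebra SmashProduct

variable {k : Type*} [Field k] {X : Type*} {A : Type u} [Ring A] [Algebra k A]
  (D : XDecomposition k X A)

/-- The projection `A → A_x`. -/
def proj (x : X) : A →ₐ[k] D.comp x := (Pi.evalAlgHom k D.comp x).comp D.equiv

variable [DecidableEq X]

/-- The inclusion `A_x → A`. -/
def incl (x : X) : D.comp x →ₗ[k] A :=
  D.equiv.symm.toLinearMap ∘ₗ LinearMap.single k D.comp x

@[simp] theorem equiv_incl (x : X) (c : D.comp x) : D.equiv (D.incl x c) = Pi.single x c := by
  simp [incl]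

@[simp] theorem proj_incl (x : X) (c : D.comp x) : D.proj x (D.incl x c) = c := by
  simp [proj]

theorem proj_incl_of_ne {x y : X} (h : y ≠ x) (c : D.comp x) : D.proj y (D.incl x c) = 0 := by
  simp [proj, h]

theorem incl_mul (x : X) (c d : D.comp x) : D.incl x (c * d) = D.incl x c * D.incl x d := by
  apply D.equiv.injective
  simp [Pi.single_mul]

/-- The projection onto a factor of a product algebra is multiplication by an idempotent, hence
linear for right multiplication. -/
theorem incl_proj_mul (x : X) (a b : A) :
    D.incl x (D.proj x (a * b)) = D.incl x (D.proj x a) * b := by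
  apply D.equiv.injective
  ext y
  rcases eq_or_ne y x with rfl | h
  · simp [proj]
  · simp [proj, h]

theorem sum_incl_proj [Fintype X] (a : A) : ∑ x, D.incl x (D.proj x a) = a := by
  apply D.equiv.injective
  simp only [map_sum, equiv_incl]
  exact Finset.univ_sum_single _

variable [Fintype X]

/-- The canonical action of `U_X(Der_X(A)) # k(Aut_X(A))` on `A`, as a linear map. -/
def canonicalActionLinear : D.derAction.Smash →ₗ[k] Module.End k A :=
  SmashProduct.lift _ fun m =>
    LinearMap.llcomp k A (D.comp m.tgt) A (D.incl m.tgt) ∘ₗ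
      (LinearMap.lcomp k (D.comp m.tgt)
        ((show D.comp m.src ≃ₐ[k] D.comp m.tgt from m.hom).toLinearMap ∘ₗ
          (D.proj m.src).toLinearMap)) ∘ₗ
      (derEnvRep k (D.comp m.tgt)).toLinearMap

theorem canonicalActionLinear_mk {x y : X} (g : D.comp x ≃ₐ[k] D.comp y)
    (a : UniversalEnvelopingAlgebra k (D.Der y)) (c : A) :
    D.canonicalActionLinear (SmashProduct.mk D.derAction.toHopfAction (x := x) (y := y) g a) c =
      D.incl y (derEnvRep k (D.comp y) a (g (D.proj x c))) := by
  rw [canonicalActionLinear, lift_mk]; rfl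

/-- The canonical action of `U_X(Der_X(A)) # k(Aut_X(A))` on `A`. -/
def canonicalAction : D.derAction.Smash →ₐ[k] Module.End k A :=
  AlgHom.ofLinearMap D.canonicalActionLinear
    (by
      ext c
      rw [one_def, map_sum, LinearMap.sum_apply]
      -- Each `f_x` acts as the projection to `A_x`, and these projections sum to the identity.
      refine (Finset.sum_congr rfl fun x _ => ?_).trans (D.sum_incl_proj c)
      refine (D.canonicalActionLinear_mk AlgEquiv.refl 1 c).trans ?_
      simp)
    (fun a b => by
      induction a using induction_on with
      | h0 => simp
      | hadd a a' ha ha' => simp only [add_mul, map_add, ha, ha']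
      | hmk g a =>
        induction b using induction_on with
        | h0 => simp
        | hadd a a' ha ha' => simp only [mul_add, map_add, ha, ha']
        | hmk h b =>
          rename_i x y x' y'
          ext c
          by_cases e : x = y'
          · subst e
            rw [mk_mul_mk, Module.End.mul_apply, canonicalActionLinear_mk,
              canonicalActionLinear_mk, canonicalActionLinear_mk, proj_incl, map_mul]
            -- Moving `g` past `b` replaces `b` by its conjugate `g · b`, as in the smash product.
            exact congrArg (fun c => D.incl _ (derEnvRep k _ a c))
              (derEnvRep_conj g b (AlgEquiv.toAlgHom h (D.proj _ c)))
          · rw [mk_mul_mk_of_ne _ _ _ _ e, Module.End.mul_apply, canonicalActionLinear_mk,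
              canonicalActionLinear_mk, proj_incl_of_ne _ e]
            simp)

theorem canonicalAction_mk {x y : X} (g : D.comp x ≃ₐ[k] D.comp y)
    (a : UniversalEnvelopingAlgebra k (D.Der y)) (c : A) :
    D.canonicalAction (SmashProduct.mk D.derAction.toHopfAction (x := x) (y := y) g a) c =
      D.incl y (derEnvRep k (D.comp y) a (g (D.proj x c))) :=
  D.canonicalActionLinear_mk g a c

theorem canonicalAction_base (x : X) (c : A) :
    D.canonicalAction (D.derAction.base x) c = D.incl x (D.proj x c) := by
  refine (D.canonicalAction_mk AlgEquiv.refl 1 c).trans ?_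
  simp

/-- `A` is a module algebra over `U_X(Der_X(A)) # k(Aut_X(A))`. -/
def canonicalModuleAlgebra : ModuleAlgebra k D.derAction.Smash A where
  ρ := D.canonicalAction
  act_mul h c d := by
    induction h using induction_on with
    | h0 => simp
    | hadd a b ha hb => simp only [map_add, LinearMap.add_apply, ha, hb]
    | hmk g a =>
      rename_i x y
      -- On both tensor factors the same `g` acts, so the statement for `a # g` reduces to the one
      -- for `a` on `A_y`; for this `t` has to be a general tensor in place of `Δ(a)`.
      have key : ∀ t : UniversalEnvelopingAlgebra k (D.Der y) ⊗[k] _,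
          D.incl y (LinearMap.mul' k _ (TensorProduct.map
            ((derEnvRep k (D.comp y)).toLinearMap.flip (AlgEquiv.toAlgHom g (D.proj x c)))
            ((derEnvRep k (D.comp y)).toLinearMap.flip (AlgEquiv.toAlgHom g (D.proj x d))) t)) =
          LinearMap.mul' k A (TensorProduct.map (D.canonicalAction.toLinearMap.flip c)
            (D.canonicalAction.toLinearMap.flip d)
            (TensorProduct.map (SmashProduct.mk D.derAction.toHopfAction g) (SmashProduct.mk _ g) t)) := by
        intro t
        induction t using TensorProduct.induction_on with
        | zero => simp
        | add s t hs ht => simp only [map_add, hs, ht]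
        | tmul s t =>
          simp only [TensorProduct.map_tmul, LinearMap.mul'_apply, LinearMap.flip_apply,
            AlgHom.toLinearMap_apply, incl_mul, canonicalAction_mk]
          rfl
      rw [comul_mk, ← key, ← derEnvRep_mul, canonicalAction_mk, map_mul, map_mul]
      rfl
  act_one h := by
    induction h using induction_on with
    | h0 => simp [targetCounital_eq]
    | hadd a b ha hb =>
      have : targetCounital k (a + b) = targetCounital k a + targetCounital k b := by
        simp [targetCounital_eq, mul_add, add_smul, Finset.sum_add_distrib]
      simp only [this, map_add, LinearMap.add_apply, ha, hb]
    | hmk g a =>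
      rename_i x y
      rw [targetCounital_mk, canonicalAction_mk, map_smul, LinearMap.smul_apply]
      erw [canonicalAction_base]
      -- The projection and `g` preserve units and `a` multiplies `1` by `ε(a)`, while `ε_t(a # g) =
      -- ε(a) f_y`.
      rw [map_one, map_one, derEnvRep_one, map_one, map_smul]

end XDecomposition

/-! ## Restriction of module algebra structures -/

section Restriction

open Coalgebra

variable {k : Type*} [Field k] {X : Type*} {H K : Type*} [Ring H] [Algebra k H]
  [WeakHopfAlgebra k H] [Ring K] [Algebra k K] [WeakHopfAlgebra k K] {e : X → H} {e' : X → K}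

/-- Since `ε_t(h) = h₁ S(h₂)`, it is preserved by any map that respects product, coproduct and
antipode. Restriction needs this for the condition on `h · 1`. -/
theorem XWeakHopfHom.map_targetCounital (φ : XWeakHopfHom k e e') (h : H) :
    φ.toBialgHom (targetCounital k h) = targetCounital k (φ.toBialgHom h) := by
  have key : ∀ t : H ⊗[k] H,
      φ.toBialgHom (LinearMap.mul' k H ((WeakHopfAlgebra.weakAntipode k).lTensor H t)) =
      LinearMap.mul' k K ((WeakHopfAlgebra.weakAntipode k).lTensor K
        (TensorProduct.map (φ.toBialgHom : H →ₗ[k] K) (φ.toBialgHom : H →ₗ[k] K) t)) := by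
    intro t
    induction t using TensorProduct.induction_on with
    | zero => simp
    | add s t hs ht => simp only [map_add, hs, ht]
    | tmul s t =>
      have : φ.toBialgHom (WeakHopfAlgebra.weakAntipode k t) =
        WeakHopfAlgebra.weakAntipode k (φ.toBialgHom t) := φ.map_antipode t
      simp [this]
  rw [← WeakHopfAlgebra.mul_antipode, key, ← WeakHopfAlgebra.mul_antipode]
  congr 2
  exact CoalgHomClass.map_comp_comul_apply φ.toBialgHom h

/-- Restriction of a module algebra structure along a homomorphism of weak Hopf algebras. -/
def ModuleAlgebra.restrict {A : Type*} [Ring A] [Algebra k A] (M : ModuleAlgebra k K A)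
    (φ : XWeakHopfHom k e e') : ModuleAlgebra k H A where
  ρ := M.ρ.comp (φ.toBialgHom : H →ₐ[k] K)
  act_mul h a b := by
    have hc : comul (R := k) (φ.toBialgHom h) = TensorProduct.map (φ.toBialgHom : H →ₗ[k] K)
        (φ.toBialgHom : H →ₗ[k] K) (comul h) :=
      (CoalgHomClass.map_comp_comul_apply φ.toBialgHom h).symm
    refine (M.act_mul (φ.toBialgHom h) a b).trans ?_
    rw [hc, ← LinearMap.comp_apply (TensorProduct.map _ _), ← TensorProduct.map_comp]
    rfl
  act_one h := by
    refine (M.act_one (φ.toBialgHom h)).trans ?_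
    rw [← φ.map_targetCounital]
    rfl

end Restriction

/-! ### Components of a decomposition, and the restricted canonical action -/

namespace XDecomposition

open Coalgebra SmashProduct

variable {k : Type*} [Field k] {X : Type*} {A : Type u} [Ring A] [Algebra k A]

section

variable (D : XDecomposition k X A) [DecidableEq X]

theorem mem_component_iff {x : X} {a : A} : a ∈ D.component x ↔ D.incl x (D.proj x a) = a := by
  constructor
  · rintro ⟨c, rfl⟩
    exact congrArg (D.incl x) (D.proj_incl x c)
  · exact fun h => ⟨_, h⟩

/-- The unit of `A_x`, viewed in `A`, is the idempotent whose multiplication is the projection to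
`A_x`. Compatibility therefore follows once `f_x · 1` is this unit. -/
theorem coe_component (x : X) :
    (D.component x : Set A) = Set.range fun a => D.incl x 1 * a := by
  have h (a : A) : D.incl x 1 * a = D.incl x (D.proj x a) := by
    have := D.incl_proj_mul x 1 a
    rwa [one_mul, map_one, eq_comm] at this
  ext a
  simp only [h, SetLike.mem_coe, mem_component_iff, Set.mem_range]
  constructor
  · exact fun h => ⟨a, h⟩
  · rintro ⟨b, rfl⟩
    rw [proj_incl]

variable [Fintype X] {𝒢 : Groupoid.{v} X} {𝔤 : X → Type w}
  [∀ x, LieRing (𝔤 x)] [∀ x, LieAlgebra k (𝔤 x)] {α : LieAction k 𝒢 𝔤}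

/-- Because `φ` preserves the `f_x`, each acts through the projection to `A_x`, and `f_x · 1` is the
unit of `A_x`. -/
theorem compatibleWith_restrict (φ : XWeakHopfHom k α.base D.derAction.base) :
    D.CompatibleWith (D.canonicalModuleAlgebra.restrict φ) α.base := fun x => by
  have : (D.canonicalModuleAlgebra.restrict φ).ρ (α.base x) = D.canonicalAction (D.derAction.base x) :=
    congrArg D.canonicalAction (φ.map_base x)
  rw [coe_component, this, canonicalAction_base, map_one (D.proj x)]

end

end XDecomposition

/-! ## Homomorphisms of smash products -/

section SmashHom

open Coalgebra SmashProduct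

variable {k : Type*} [Field k] {X : Type*} {𝒢 : Groupoid.{v} X} {𝒢' : Groupoid.{v'} X} {B B' : X → Type*}
  [∀ x, Ring (B x)] [∀ x, HopfAlgebra k (B x)] [∀ x, Ring (B' x)] [∀ x, HopfAlgebra k (B' x)]
  {act : HopfAction k 𝒢 B} {act' : HopfAction k 𝒢' B'}

theorem XGroupoidHom.map_inv (π : XGroupoidHom 𝒢 𝒢') {x y : X} (g : 𝒢.Hom x y) :
    π.map (𝒢.inv g) = 𝒢'.inv (π.map g) := by
  have h : 𝒢'.comp (π.map (𝒢.inv g)) (π.map g) = 𝒢'.id y := by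
    rw [← π.map_comp, 𝒢.inv_comp, π.map_id]
  calc π.map (𝒢.inv g) = 𝒢'.comp (𝒢'.comp (π.map (𝒢.inv g)) (π.map g)) (𝒢'.inv (π.map g)) := by
        rw [𝒢'.assoc, 𝒢'.comp_inv, 𝒢'.comp_id]
    _ = _ := by rw [h, 𝒢'.id_comp]

variable (act act') in
/-- The linear map `a # g ↦ τ(a) # π(g)`. -/
def smashMapLinear (π : XGroupoidHom 𝒢 𝒢') (τ : ∀ x, B x →ₐc[k] B' x) :
    SmashProduct act →ₗ[k] SmashProduct act' :=
  SmashProduct.lift act fun m =>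
    SmashProduct.mk act' (π.map m.hom) ∘ₗ (τ m.tgt : B m.tgt →ₗ[k] B' m.tgt)

theorem smashMapLinear_mk (π : XGroupoidHom 𝒢 𝒢') (τ : ∀ x, B x →ₐc[k] B' x)
    {x y : X} (g : 𝒢.Hom x y) (b : B y) :
    smashMapLinear act act' π τ (SmashProduct.mk act g b) =
      SmashProduct.mk act' (π.map g) (τ y b) :=
  lift_mk _ _ _

variable [DecidableEq X] [Fintype X]

/-- The product `a (g · b) # gh` goes to `τ(a) τ(g · b) # π(g) π(h)`, and `hτ` rewrites the middle
factor. Non-composable pairs stay non-composable because `π` fixes the objects. -/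
theorem smashMapLinear_mul (π : XGroupoidHom 𝒢 𝒢') (τ : ∀ x, B x →ₐc[k] B' x)
    (hτ : ∀ {x y : X} (g : 𝒢.Hom x y) (b : B x),
      τ y (act.map g b) = act'.map (π.map g) (τ x b)) (a b : SmashProduct act) :
    smashMapLinear act act' π τ (a * b) =
      smashMapLinear act act' π τ a * smashMapLinear act act' π τ b := by
  induction a using induction_on with
  | h0 => simp
  | hadd a a' ha ha' => simp only [add_mul, map_add, ha, ha']
  | hmk g a =>
    induction b using induction_on with
    | h0 => simp
    | hadd a a' ha ha' => simp only [mul_add, map_add, ha, ha']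
    | hmk h b =>
      rename_i x y x' y'
      by_cases e : x = y'
      · subst e
        simp only [mk_mul_mk, smashMapLinear_mk, π.map_comp, map_mul, hτ]
      · simp only [mk_mul_mk_of_ne _ _ _ _ e, smashMapLinear_mk, map_zero]

/-- The homomorphism of smash products `a # g ↦ τ(a) # π(g)`. -/
def smashMap (π : XGroupoidHom 𝒢 𝒢') (τ : ∀ x, B x →ₐc[k] B' x)
    (hτ : ∀ {x y : X} (g : 𝒢.Hom x y) (b : B x),
      τ y (act.map g b) = act'.map (π.map g) (τ x b))
    (hS : ∀ x (b : B x), τ x (HopfAlgebra.antipode k b) = HopfAlgebra.antipode k (τ x b)) :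
    XWeakHopfHom k (base act) (base act') where
  __ := smashMapLinear act act' π τ
  counit_comp := by
    ext a
    induction a using induction_on with
    | h0 => simp
    | hadd a b ha hb => simp only [map_add, ha, hb]
    | hmk g a =>
      rw [LinearMap.comp_apply, smashMapLinear_mk, counit_mk, counit_mk]
      exact CoalgHomClass.counit_comp_apply (τ _) a
  map_comp_comul := by
    ext a
    induction a using induction_on with
    | h0 => simp
    | hadd a b ha hb => simp only [map_add, ha, hb]
    | hmk g a =>
      rename_i x y
      -- On the summand of `g` the map is `τ y` into the summand of `π(g)`, and both coproducts are
      -- formed within summands.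
      have h : smashMapLinear act act' π τ ∘ₗ SmashProduct.mk act g =
          SmashProduct.mk act' (π.map g) ∘ₗ (τ y : B y →ₗ[k] B' y) :=
        LinearMap.ext (smashMapLinear_mk π τ g)
      rw [LinearMap.comp_apply, LinearMap.comp_apply, smashMapLinear_mk, comul_mk, comul_mk,
        ← LinearMap.comp_apply (TensorProduct.map _ _), ← TensorProduct.map_comp, h,
        TensorProduct.map_comp, LinearMap.comp_apply]
      exact congrArg _ (CoalgHomClass.map_comp_comul_apply (τ y) a)
  map_one' := by
    change smashMapLinear act act' π τ 1 = 1
    simp [one_def, smashMapLinear_mk, π.map_id]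
  map_mul' := smashMapLinear_mul π τ hτ
  map_antipode h := by
    change smashMapLinear act act' π τ (SmashProduct.antipode act h) =
      SmashProduct.antipode act' (smashMapLinear act act' π τ h)
    induction h using induction_on with
    | h0 => simp
    | hadd a b ha hb => simp only [map_add, ha, hb]
    | hmk g a => rw [antipode_mk, smashMapLinear_mk, smashMapLinear_mk, antipode_mk, hτ, hS,
        π.map_inv]
  map_base x := by
    change smashMapLinear act act' π τ (base act x) = base act' x
    rw [base, smashMapLinear_mk, π.map_id, map_one, base]

end SmashHom

section Antipode

attribute [local instance] LieRing.ofAssociativeRing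

/-- As the antipode is an algebra map to the opposite algebra, both composites are algebra maps, and
on generators both are `p ↦ -f(p)`. -/
theorem univEnvMapBialg_antipode {k : Type*} [Field k] {L M : Type*} [LieRing L] [LieAlgebra k L]
    [LieRing M] [LieAlgebra k M] (f : L →ₗ⁅k⁆ M) (a : UniversalEnvelopingAlgebra k L) :
    univEnvMapBialg f (HopfAlgebra.antipode k a) =
      HopfAlgebra.antipode k (univEnvMapBialg f a) := by
  have h : (AlgHom.op (univEnvMap f)).comp (univEnvAntipode k L) =
      (univEnvAntipode k M).comp (univEnvMap f) := by
    refine univEnv_algHom_ext k fun p => ?_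
    have hf (p : L) : univEnvMap f (UniversalEnvelopingAlgebra.ι k p) =
        UniversalEnvelopingAlgebra.ι k (f p) := univEnvMapBialg_ι f p
    rw [AlgHom.comp_apply, AlgHom.comp_apply, hf, univEnvAntipode_ι, univEnvAntipode_ι, ← hf]
    exact congrArg MulOpposite.op ((univEnvMap f).map_neg (UniversalEnvelopingAlgebra.ι k p))
  exact congrArg MulOpposite.unop (AlgHom.congr_fun h a)

end Antipode

theorem actionRep_mk {k : Type*} [Field k] {X : Type*} [DecidableEq X] [Fintype X]
    {𝒢 : Groupoid.{v} X} {B : X → Type*} [∀ x, Ring (B x)] [∀ x, HopfAlgebra k (B x)]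
    (act : HopfAction k 𝒢 B) {x y : X} (g : 𝒢.Hom x y) (c : k) (m : ∀ x, B x) :
    actionRep act (SmashProduct.mk (trivialAction k 𝒢) g c) m =
      c • Pi.single y (act.map g (m x)) := by
  rw [actionRep, AlgHom.ofLinearMap_apply, SmashProduct.lift_mk]
  rfl

theorem groupoidAlgebraMap_mk {k : Type*} [Field k] {X : Type*} [DecidableEq X] [Fintype X]
    {𝒢 : Groupoid.{v} X} {𝒢' : Groupoid.{v'} X} (π : XGroupoidHom 𝒢 𝒢') {x y : X}
    (g : 𝒢.Hom x y) (c : k) :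
    groupoidAlgebraMap π (SmashProduct.mk (trivialAction k 𝒢) g c) =
      SmashProduct.mk (trivialAction k 𝒢') (π.map g) c := by
  rw [groupoidAlgebraMap, AlgHom.ofLinearMap_apply, SmashProduct.lift_mk]

/-! ### Linearity of `τ̃` over `π̃` as equivariance -/

namespace XDecomposition

variable {k : Type*} [Field k] {X : Type*} {A : Type u} [Ring A] [Algebra k A]
  (D : XDecomposition k X A) [DecidableEq X] [Fintype X] {𝒢 : Groupoid.{v} X} {𝔤 : X → Type w}
  [∀ x, LieRing (𝔤 x)] [∀ x, LieAlgebra k (𝔤 x)] (α : LieAction k 𝒢 𝔤)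

/-- The groupoid algebra is spanned by morphisms, and `g : x → y` sees only the `x`-component of `m`
and fills only the `y`-component. What remains is the hypothesis `hτ` of `smashMap`. -/
theorem univEnvXMap_linear_iff (π : XGroupoidHom 𝒢 D.autGroupoid) (τ : XLieHom k 𝔤 D.Der) :
    (∀ (r : GroupoidAlgebra k 𝒢) (m : ∀ x, UniversalEnvelopingAlgebra k (𝔤 x)),
      univEnvXMap τ (actionRep α.toHopfAction r m) =
        actionRep D.derAction.toHopfAction (groupoidAlgebraMap π r) (univEnvXMap τ m)) ↔
    ∀ {x y : X} (g : 𝒢.Hom x y) (a : UniversalEnvelopingAlgebra k (𝔤 x)),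
      univEnvMapBialg (τ y) (α.toHopfAction.map g a) =
        D.derAction.toHopfAction.map (π.map g) (univEnvMapBialg (τ x) a) := by
  have hs (y : X) (b : UniversalEnvelopingAlgebra k (𝔤 y)) :
      univEnvXMap τ (Pi.single y b) = Pi.single y (univEnvMapBialg (τ y) b) := by
    ext z
    change univEnvMapBialg (τ z) ((Pi.single y b : ∀ x, UniversalEnvelopingAlgebra k (𝔤 x)) z) = _
    rcases eq_or_ne z y with rfl | h
    · rw [Pi.single_eq_same, Pi.single_eq_same]
    · rw [Pi.single_eq_of_ne h, Pi.single_eq_of_ne h, map_zero]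
  constructor
  · intro h x y g a
    have := congrFun (h (SmashProduct.mk _ g 1) (Pi.single x a)) y
    rwa [groupoidAlgebraMap_mk, actionRep_mk, actionRep_mk, one_smul, one_smul, hs, hs,
      Pi.single_eq_same, Pi.single_eq_same, Pi.single_eq_same, Pi.single_eq_same] at this
  · intro h r m
    induction r using SmashProduct.induction_on with
    | h0 => simp
    | hadd a b ha hb => simp only [map_add, LinearMap.add_apply, ha, hb]
    | hmk g c =>
      rw [groupoidAlgebraMap_mk, actionRep_mk, actionRep_mk, map_smul, hs, h]
      rfl

variable {D α} in
theorem HasLinearHoms.nonempty_hom (h : D.HasLinearHoms α) :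
    Nonempty (XWeakHopfHom k α.base D.derAction.base) := by
  obtain ⟨π, τ, h⟩ := h
  rw [univEnvXMap_linear_iff] at h
  exact ⟨smashMap π (fun x => univEnvMapBialg (τ x)) h
    fun x => univEnvMapBialg_antipode (τ x)⟩

end XDecomposition

/-! ## From module algebra structures to groupoid and Lie algebroid homomorphisms -/

namespace XDecomposition

open Coalgebra SmashProduct UniversalEnvelopingAlgebra

variable {k : Type*} [Field k] {X : Type*} {A : Type u} [Ring A] [Algebra k A]
  [DecidableEq X] [Fintype X] {𝒢 : Groupoid.{v} X} {𝔤 : X → Type w}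
  [∀ x, LieRing (𝔤 x)] [∀ x, LieAlgebra k (𝔤 x)] {α : LieAction k 𝒢 𝔤}
  (M : ModuleAlgebra k α.Smash A)

theorem act_grouplike_mul {x y : X} (g : 𝒢.Hom x y) (a b : A) :
    M.ρ (SmashProduct.mk _ g 1) (a * b) =
      M.ρ (SmashProduct.mk _ g 1) a * M.ρ (SmashProduct.mk _ g 1) b := by
  rw [M.act_mul, comul_mk, Bialgebra.comul_one, Algebra.TensorProduct.one_def]
  rfl

theorem act_grouplike_one {x y : X} (g : 𝒢.Hom x y) :
    M.ρ (SmashProduct.mk _ g 1) 1 = M.ρ (α.base y) 1 := by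
  rw [M.act_one, targetCounital_mk, Bialgebra.counit_one, one_smul]

/-- `Δ(p # e_x) = (p # e_x) ⊗ f_x + f_x ⊗ (p # e_x)`: a Leibniz rule twisted by `f_x`. -/
theorem act_primitive_mul (x : X) (p : 𝔤 x) (a b : A) :
    M.ρ (SmashProduct.mk _ (𝒢.id x) (ι k p)) (a * b) =
      M.ρ (SmashProduct.mk _ (𝒢.id x) (ι k p)) a * M.ρ (α.base x) b +
      M.ρ (α.base x) a * M.ρ (SmashProduct.mk _ (𝒢.id x) (ι k p)) b := by
  have h : comul (R := k) (ι k p) = ι k p ⊗ₜ 1 + 1 ⊗ₜ ι k p := univEnvComul_ι k p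
  rw [M.act_mul, comul_mk, h, map_add, map_add, map_add]
  rfl

theorem act_base_mul (x : X) (a b : A) :
    M.ρ (α.base x) (a * b) = M.ρ (α.base x) a * M.ρ (α.base x) b :=
  act_grouplike_mul M _ a b

theorem act_base_act_base (x y : X) (a : A) :
    M.ρ (α.base x) (M.ρ (α.base y) a) = if x = y then M.ρ (α.base x) a else 0 := by
  rw [← Module.End.mul_apply, ← map_mul, base_mul_base]
  split_ifs <;> simp

theorem sum_act_base (a : A) : ∑ x, M.ρ (α.base x) a = a := by
  have h : ∑ x, α.base x = 1 := rfl
  rw [← LinearMap.sum_apply, ← map_sum, h, map_one, Module.End.one_apply]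

/-- Applying `f_z` to the product applies it to both factors; one of them dies, since `z` cannot
equal both `x` and `y`. All components of the product vanish. -/
theorem act_base_mul_act_base {x y : X} (h : x ≠ y) (a b : A) :
    M.ρ (α.base x) a * M.ρ (α.base y) b = 0 := by
  rw [← sum_act_base M (_ * _)]
  refine Finset.sum_eq_zero fun z _ => ?_
  rw [act_base_mul, act_base_act_base, act_base_act_base]
  split_ifs with h₁ h₂
  · exact absurd (h₁.symm.trans h₂) h
  all_goals simp

/-- In `a = ∑ f_y · a` only `y = x` survives multiplication by `f_x · 1`. Together with the
right-handed version this makes `f_x · 1` central. -/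
theorem act_base_one_mul (x : X) (a : A) : M.ρ (α.base x) 1 * a = M.ρ (α.base x) a := by
  conv_lhs => rw [← sum_act_base M a, Finset.mul_sum, Finset.sum_eq_single x
    (fun y _ h => act_base_mul_act_base M h.symm _ _) (by simp), ← act_base_mul, one_mul]

theorem mul_act_base_one (x : X) (a : A) : a * M.ρ (α.base x) 1 = M.ρ (α.base x) a := by
  conv_lhs => rw [← sum_act_base M a, Finset.sum_mul, Finset.sum_eq_single x
    (fun y _ h => act_base_mul_act_base M h _ _) (by simp), ← act_base_mul, mul_one]

theorem completeOrthogonalIdempotents_act_base :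
    CompleteOrthogonalIdempotents fun x => M.ρ (α.base x) 1 where
  idem x := by
    change _ * _ = _
    rw [← act_base_mul, mul_one]
  ortho x y h := act_base_mul_act_base M h _ _
  complete := sum_act_base M 1

/-- The decomposition of an algebra given by central orthogonal idempotents. -/
def ofCentralIdempotents {e : X → A} (he : CompleteOrthogonalIdempotents e)
    (hc : ∀ x, IsMulCentral (e x)) : XDecomposition k X A :=
  letI f (x : X) : A →+* (he.idem x).Corner :=
    (Pi.evalRingHom _ x).comp (he.ringEquivOfIsMulCentral hc).toRingHom
  have hf (x : X) : Function.Surjective (f x) := by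
    rintro ⟨_, a, rfl⟩
    exact ⟨a, rfl⟩
  -- The corner gets its scalars from `A` along `f x`, whose surjectivity makes them central;
  -- `equiv` then respects scalars by definition.
  letI (x : X) : Algebra k (he.idem x).Corner := ((f x).comp (algebraMap k A)).toAlgebra'
    fun c a => by
      obtain ⟨b, rfl⟩ := hf x a
      rw [RingHom.comp_apply, ← map_mul, ← map_mul, Algebra.commutes]
  { comp := fun x => (he.idem x).Corner
    equiv := AlgEquiv.ofRingEquiv (f := he.ringEquivOfIsMulCentral hc) fun c => rfl }

theorem incl_ofCentralIdempotents {e : X → A} (he : CompleteOrthogonalIdempotents e)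
    (hc : ∀ x, IsMulCentral (e x)) (x : X) :
    (ofCentralIdempotents (k := k) he hc).incl x 1 = e x := by
  apply (ofCentralIdempotents (k := k) he hc).equiv.injective
  rw [equiv_incl]
  ext y
  refine Subtype.ext ?_
  -- The component at `y` of an element `a` is `e y * a * e y`, and the unit of the corner at `y` is
  -- `e y`.
  change _ = e y * e x * e y
  rcases eq_or_ne y x with rfl | h
  · rw [Pi.single_eq_same, (he.idem y).eq, (he.idem y).eq]
    rfl
  · rw [Pi.single_eq_of_ne h, he.ortho h, zero_mul]
    rfl

theorem exists_compatibleWith : ∃ D : XDecomposition k X A, D.CompatibleWith M α.base := by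
  have hc (x : X) : IsMulCentral (M.ρ (α.base x) 1) :=
    Semigroup.mem_center_iff.mpr fun a => by rw [act_base_one_mul, mul_act_base_one]
  refine ⟨ofCentralIdempotents (completeOrthogonalIdempotents_act_base M) hc, fun x => ?_⟩
  rw [coe_component, incl_ofCentralIdempotents]

/-! ### The maps between components given by the action -/

variable {M} {D : XDecomposition k X A}

/-- Compatibility puts `f_y · a` in `A_y`, so `a = ∑ f_y · a` is the decomposition of `a` into
components. -/
theorem CompatibleWith.act_base (h : D.CompatibleWith M α.base) (x : X) (a : A) :
    M.ρ (α.base x) a = D.incl x (D.proj x a) := by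
  have hx (y : X) : D.incl y (D.proj y (M.ρ (α.base y) a)) = M.ρ (α.base y) a := by
    rw [← mem_component_iff, ← SetLike.mem_coe, h y]
    exact ⟨a, act_base_one_mul M y a⟩
  conv_rhs => rw [← sum_act_base M a, map_sum, Finset.sum_eq_single x
    (fun y _ hy => by rw [← hx, proj_incl_of_ne _ hy.symm]) (by simp), hx]

variable (M D) in
/-- The map `A_x → A_y` given by the action of `a # g`. -/
def compress {x y : X} (g : 𝒢.Hom x y) :
    UniversalEnvelopingAlgebra k (𝔤 y) →ₗ[k] D.comp x →ₗ[k] D.comp y :=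
  (LinearMap.llcomp k (D.comp x) A (D.comp y) (D.proj y).toLinearMap) ∘ₗ
    (LinearMap.lcomp k A (D.incl x)) ∘ₗ M.ρ.toLinearMap ∘ₗ SmashProduct.mk α.toHopfAction g

theorem compress_apply {x y : X} (g : 𝒢.Hom x y) (a : UniversalEnvelopingAlgebra k (𝔤 y))
    (c : D.comp x) :
    compress M D g a c = D.proj y (M.ρ (SmashProduct.mk _ g a) (D.incl x c)) := rfl

namespace CompatibleWith

variable (h : D.CompatibleWith M α.base)
include h

/-- From `f_y (a # g) = a # g`, the values already lie in `A_y`, so the projection in `compress`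
loses nothing. -/
theorem incl_compress {x y : X} (g : 𝒢.Hom x y) (a : UniversalEnvelopingAlgebra k (𝔤 y))
    (c : D.comp x) :
    D.incl y (compress M D g a c) = M.ρ (SmashProduct.mk _ g a) (D.incl x c) := by
  rw [compress_apply, ← h.act_base, ← Module.End.mul_apply, ← map_mul, LieAction.base, base,
    mk_mul_mk, 𝒢.comp_id, map_id_apply, one_mul]

/-- Turns identities in `H` into identities between maps of components; functoriality, brackets and
conjugation all come from it. -/
theorem compress_compress {x y z : X} (g : 𝒢.Hom x y) (g' : 𝒢.Hom y z)
    (a : UniversalEnvelopingAlgebra k (𝔤 y)) (b : UniversalEnvelopingAlgebra k (𝔤 z))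
    (c : D.comp x) :
    compress M D g' b (compress M D g a c) =
      compress M D (𝒢.comp g g') (b * α.toHopfAction.map g' a) c := by
  rw [compress_apply, h.incl_compress, ← Module.End.mul_apply, ← map_mul, mk_mul_mk]
  rfl

theorem compress_id_one (x : X) (c : D.comp x) : compress M D (𝒢.id x) 1 c = c := by
  have := h.act_base x (D.incl x c)
  rw [LieAction.base, base] at this
  rw [compress_apply, this, proj_incl, proj_incl]

omit h in
theorem compress_grouplike_mul {x y : X} (g : 𝒢.Hom x y) (c d : D.comp x) :
    compress M D g 1 (c * d) = compress M D g 1 c * compress M D g 1 d := by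
  simp only [compress_apply, incl_mul, act_grouplike_mul, map_mul]

/-- The unit of `A_x` is `f_x · 1`, and `(1 # g) f_x = 1 # g` sends `1` to `ε_t(1 # g) · 1 = f_y ·
1`, the unit of `A_y`. -/
theorem compress_grouplike_one {x y : X} (g : 𝒢.Hom x y) : compress M D g 1 1 = 1 := by
  have h₁ : D.incl x 1 = M.ρ (α.base x) 1 := by rw [h.act_base, map_one (D.proj x)]
  rw [compress_apply, h₁, ← Module.End.mul_apply, ← map_mul, LieAction.base, base, mk_mul_mk,
    𝒢.id_comp, map_one (α.toHopfAction.map g), mul_one, act_grouplike_one, h.act_base, proj_incl, map_one]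

/-- The algebra map `A_x → A_y` given by the action of a morphism `g : x → y`. -/
def groupoidAlgHom {x y : X} (g : 𝒢.Hom x y) : D.comp x →ₐ[k] D.comp y :=
  AlgHom.ofLinearMap (compress M D g 1) (h.compress_grouplike_one g)
    (compress_grouplike_mul g)

theorem groupoidAlgHom_comp {x y z : X} (g : 𝒢.Hom x y) (g' : 𝒢.Hom y z) :
    h.groupoidAlgHom (𝒢.comp g g') = (h.groupoidAlgHom g').comp (h.groupoidAlgHom g) := by
  ext c
  refine Eq.trans ?_ (h.compress_compress g g' 1 1 c).symm
  rw [map_one, mul_one]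
  rfl

theorem groupoidAlgHom_id (x : X) : h.groupoidAlgHom (𝒢.id x) = AlgHom.id k (D.comp x) :=
  AlgHom.ext (h.compress_id_one x)

/-- The homomorphism `𝒢 → Aut_X(A)` given by a module algebra structure. -/
def groupoidHom : XGroupoidHom 𝒢 D.autGroupoid where
  map g := AlgEquiv.ofAlgHom (h.groupoidAlgHom g) (h.groupoidAlgHom (𝒢.inv g))
    (by rw [← groupoidAlgHom_comp, 𝒢.inv_comp, groupoidAlgHom_id])
    (by rw [← groupoidAlgHom_comp, 𝒢.comp_inv, groupoidAlgHom_id])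
  map_id x := AlgEquiv.ext (h.compress_id_one x)
  map_comp g g' := AlgEquiv.ext fun c => AlgHom.congr_fun (h.groupoidAlgHom_comp g g') c

/-- On `A_x` the twist `f_x` is the identity, so the twisted Leibniz rule becomes the ordinary one.
-/
theorem compress_primitive_mul (x : X) (p : 𝔤 x) (c d : D.comp x) :
    compress M D (𝒢.id x) (ι k p) (c * d) =
      c * compress M D (𝒢.id x) (ι k p) d + compress M D (𝒢.id x) (ι k p) c * d := by
  simp only [compress_apply, incl_mul, act_primitive_mul, map_mul, map_add, h.act_base,
    proj_incl]
  exact add_comm _ _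

attribute [local instance] LieRing.ofAssociativeRing

/-- The homomorphism `𝔊 → Der_X(A)` given by a module algebra structure. -/
def lieHom : XLieHom k 𝔤 D.Der := fun x =>
  { toFun := fun p => ⟨compress M D (𝒢.id x) (ι k p), h.compress_primitive_mul x p⟩
    map_add' := fun p q => Subtype.ext (by simp only [map_add]; rfl)
    map_smul' := fun c p => Subtype.ext (by simp only [map_smul]; rfl)
    map_lie' := fun {p q} => Subtype.ext (LinearMap.ext fun c => by
      change compress M D (𝒢.id x) (ι k ⁅p, q⁆) c =
        compress M D (𝒢.id x) (ι k p) (compress M D (𝒢.id x) (ι k q) c) -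
          compress M D (𝒢.id x) (ι k q) (compress M D (𝒢.id x) (ι k p) c)
      -- Over `e_x` the smash product multiplies as in `U(𝔤 x)`, where the bracket is the
      -- commutator.
      rw [h.compress_compress, h.compress_compress, 𝒢.id_comp, map_id_apply, map_id_apply,
        LieHom.map_lie, LieRing.of_associative_ring_bracket, map_sub, LinearMap.sub_apply]) }

/-- The image of the relation `(1 # g)(p # e_x)(1 # g⁻¹) = (g · p) # e_y` in `H`. -/
theorem lieHom_map {x y : X} (g : 𝒢.Hom x y) (p : 𝔤 x) :
    h.lieHom y (α.map g p) = derConj (h.groupoidHom.map g) (h.lieHom x p) := by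
  refine Subtype.ext (LinearMap.ext fun c => ?_)
  change compress M D (𝒢.id y) (ι k (α.map g p)) c = compress M D g 1
    (compress M D (𝒢.id x) (ι k p) (compress M D (𝒢.inv g) 1 c))
  have hp : α.toHopfAction.map g (ι k p) = ι k (α.map g p) := univEnvMapBialg_ι _ p
  rw [h.compress_compress, h.compress_compress, 𝒢.id_comp, 𝒢.inv_comp, map_one, mul_one, one_mul,
    hp]

/-- Equivariance on `𝔤 x` extends to `U(𝔤 x)` because both sides are bialgebra maps, determined on
generators. -/
theorem hasLinearHoms : D.HasLinearHoms α := by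
  refine ⟨h.groupoidHom, h.lieHom, (D.univEnvXMap_linear_iff α _ _).2 fun {x y} g a => ?_⟩
  have : (univEnvMapBialg (h.lieHom y)).comp (univEnvMapBialg (α.map g)) =
      (univEnvMapBialg (derConj (h.groupoidHom.map g))).comp (univEnvMapBialg (h.lieHom x)) :=
    univEnv_bialgHom_ext fun p => by
      rw [BialgHom.comp_apply, BialgHom.comp_apply, univEnvMapBialg_ι, univEnvMapBialg_ι,
        univEnvMapBialg_ι, univEnvMapBialg_ι, h.lieHom_map]
  exact DFunLike.congr_fun this a

end CompatibleWith

end XDecomposition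

end

theorem mainTheorem1 {k : Type*} [Field k] [IsAlgClosed k] [CharZero k]
    {X : Type*} [Fintype X] [DecidableEq X] [Nonempty X] {𝒢 : Groupoid.{v} X}
    {𝔤 : X → Type w} [∀ x, LieRing (𝔤 x)] [∀ x, LieAlgebra k (𝔤 x)] (α : LieAction k 𝒢 𝔤)
    (A : Type u) [Ring A] [Algebra k A] :
    -- the equivalence
    [ Nonempty (ModuleAlgebra k α.Smash A),
      ∃ D : XDecomposition k X A, D.HasLinearHoms α,
      ∃ D : XDecomposition k X A, Nonempty (XWeakHopfHom k α.base D.derAction.base) ].TFAE ∧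
    -- every module algebra structure gives the decomposition `A_x = (f_x · 1_A) A`
    (∀ M : ModuleAlgebra k α.Smash A, ∃ D : XDecomposition k X A, D.CompatibleWith M α.base) ∧
    -- the equivalence for each fixed decomposition
    (∀ D : XDecomposition k X A,
      [ ∃ M : ModuleAlgebra k α.Smash A, D.CompatibleWith M α.base,
        D.HasLinearHoms α,
        Nonempty (XWeakHopfHom k α.base D.derAction.base) ].TFAE) := by
  have fixed (D : XDecomposition k X A) :
      [ ∃ M : ModuleAlgebra k α.Smash A, D.CompatibleWith M α.base,
        D.HasLinearHoms α,
        Nonempty (XWeakHopfHom k α.base D.derAction.base) ].TFAE := by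
    tfae_have 1 → 2 := fun ⟨_, h⟩ => h.hasLinearHoms
    tfae_have 2 → 3 := fun h => h.nonempty_hom
    tfae_have 3 → 1 := fun ⟨φ⟩ =>
      ⟨D.canonicalModuleAlgebra.restrict φ, D.compatibleWith_restrict φ⟩
    tfae_finish
  refine ⟨?_, XDecomposition.exists_compatibleWith, fixed⟩
  -- Only here must a decomposition be produced; the other implications keep the given one.
  tfae_have 1 → 2 := fun ⟨M⟩ => by
    obtain ⟨D, h⟩ := XDecomposition.exists_compatibleWith M
    exact ⟨D, h.hasLinearHoms⟩
  tfae_have 2 → 3 := fun ⟨D, h⟩ => ⟨D, h.nonempty_hom⟩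
  tfae_have 3 → 1 := fun ⟨D, ⟨φ⟩⟩ => ⟨D.canonicalModuleAlgebra.restrict φ⟩
  tfae_finish
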